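/- Let $G$ be the simply connected simple algebraic group over $\mathbb C$ of type $D_r$, with Chevalley generators $e_i,f_i$ and simple coroots $h_i$ ($1\le i\le r$; the nodes $r-1$ and $r$ are both joined to $r-2$), normalized so that on the basis $v_1,\dots,v_r,v_{\bar r},\dots,v_{\bar 1}$ of the vector representation $f_iv_i=v_{i+1}$, $f_iv_{\overline{i+1}}=v_{\bar i}$ $(i<r)$, $f_rv_r=v_{\overline{r-1}}$, $f_rv_{r-1}=v_{\bar r}$, all other $f_iv_j$ are $0$, and $e_i$ is the transpose of $f_i$. Put $x_i(t)=\exp(te_i)$, $y_i(t)=\exp(tf_i)$, $x_{-i}(t)=y_i(t)\,t^{-h_i}$, $\overline{s_i}=x_i(-1)y_i(1)x_i(-1)$, and let $N$, $N_-$, $H$ be the subgroups generated by the $x_i(t)$, by the $y_i(t)$, and by the $t^{h_i}$. For a Weyl group element $u$ with reduced expression $s_{i_1}\cdots s_{i_l}$ put $\bar u=\overline{s_{i_1}}\cdots\overline{s_{i_l}}$; the generalized minor $\Delta_{u\Lambda_j,\Lambda_j}$ is the unique regular function on $G$ with $\Delta_{u\Lambda_j,\Lambda_j}(\bar u\,n_-hn)=h^{\Lambda_j}$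 for $n_-\in N_-$, $h\in H$, $n\in N$, where $\Lambda_j$ is the $j$-th fundamental weight. Let $1\le d<r-1$ and $2\le m\le r-1$, and let $\mathbf i=(i_1,\dots,i_n)$ be the word that consists of $m-1$ cycles $(1,2,\dots,r)$ followed by $(1,2,\dots,d)$, so $n=(m-1)r+d$ and $i_n=d$. Let $k=(m-2)r+d$, the position of the letter $d$ in the $(m-1)$-th cycle, so $i_k=d$, and let $u_{\le k}=s_{i_1}\cdots s_{i_k}$. For $$\mathbf Y=(Y_{1,1},\dots,Y_{1,r},\dots,Y_{m-1,1},\dots,Y_{m-1,r},Y_{m,1},\dots,Y_{m,d})\in(\mathbb C^\times)^n$$ put $\Delta^L(k;\mathbf i)(\mathbf Y)=\Delta_{u_{\le k}\Lambda_d,\Lambda_d}\bigl(x_{-1}(Y_{1,1})\cdots x_{-r}(Y_{1,r})\cdots x_{-1}(Y_{m,1})\cdots x_{-d}(Y_{m,d})\bigr)$, the factors being $x_{-i_1},\dots,x_{-i_n}$ in this order. Order $J_D=\{1,\dots,r,\bar r,\dots,\bar 1\}$ by $1<2<\cdots<r-1<r,\bar r<\overline{r-1}<\cdots<\bar 1$,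 where $r$ and $\bar r$ are incomparable. With $Y_{s,0}=1$, put $$D(l,j)=\frac{Y_{l,j-1}}{Y_{l,j}}\ (1\le j\le r-2),\quad D(l,r-1)=\frac{Y_{l,r-2}}{Y_{l,r-1}Y_{l,r}},\quad D(l,r)=\frac{Y_{l,r-1}}{Y_{l+1,r}},$$ $$D(l,\overline{r-1})=\frac{Y_{l,r}Y_{l,r-1}}{Y_{l+1,r-2}},\qquad D(l,\bar j)=\frac{Y_{l,j}}{Y_{l+1,j-1}}\ (1\le j\le r-2\text{ or }j=r).$$ Then $$\Delta^L(k;\mathbf i)(\mathbf Y)=\sum D(l_1,k_1)D(l_2,k_2)\cdots D(l_d,k_d),$$ where the sum runs over all $(k_1,\dots,k_d)\in J_D^d$ such that - $k_i\not\ge k_{i+1}$ for $1\le i<d$, - $i\le k_i\le m-1+i$ for all $i\le d$ with $i\le r-m$, - $i\le k_i\le\overline{d-i+1}$ for all $i\le d$ with $i>r-m$, and where $l_i=m-k_i+i$ if $k_i\in\{1,\dots,r-1\}$, and $l_i=m-r+i$ if $k_i\in\{r,\bar r,\dots,\bar 1\}$. -/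

import Mathlib

open scoped Matrix

namespace TypeD

noncomputable section

/-! The index set `I = {1, …, r}` of the Dynkin diagram is `Fin r`; the element `i : Fin r` stands
for the node `i + 1`. -/

/-- The set `J_D = {1, …, r, r̄, …, 1̄}`: the letter `j` is the integer `j`, and the letter `j̄` is
the integer `-j`. -/
abbrev JD (r : ℕ) : Type := ↥((Finset.Icc (-(r : ℤ)) (r : ℤ)).erase 0)

/-- Height of a letter in the order `1 < 2 < ⋯ < r-1 < {r, r̄} < (r-1)̄ < ⋯ < 1̄`; the only two
different letters of the same height are `r` and `r̄`. -/
def height (r : ℕ) (a : ℤ) : ℤ := if 0 < a then a else 2 * (r : ℤ) + a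

/-- The partial order on `J_D`; the letters `r` and `r̄` are not comparable. -/
def ordLE (r : ℕ) (a b : ℤ) : Prop := a = b ∨ height r a < height r b

/-! ### The representations `V(Λ_1)` and `V_sp^+ ⊕ V_sp^-` of `so(2r)` -/

/-- `f_i` on `V(Λ_1)`: for `i < r` it sends `v_i ↦ v_{i+1}` and `v_{(i+1)̄} ↦ v_{ī}`; moreover
`f_r` sends `v_r ↦ v_{(r-1)̄}` and `v_{r-1} ↦ v_{r̄}`; all other basis vectors go to `0`. -/
def fVec (r : ℕ) (i : Fin r) : Matrix (JD r) (JD r) ℂ :=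
  Matrix.of fun a b =>
    let n : ℤ := (i : ℤ) + 1
    if n < r then
      if ((b : ℤ) = n ∧ (a : ℤ) = n + 1) ∨ ((b : ℤ) = -(n + 1) ∧ (a : ℤ) = -n) then 1 else 0
    else
      if ((b : ℤ) = n ∧ (a : ℤ) = -(n - 1)) ∨ ((b : ℤ) = n - 1 ∧ (a : ℤ) = -n) then 1 else 0

/-- `e_i` on `V(Λ_1)`: for `i < r` it sends `v_{i+1} ↦ v_i` and `v_{ī} ↦ v_{(i+1)̄}`; moreover
`e_r` sends `v_{r̄} ↦ v_{r-1}` and `v_{(r-1)̄} ↦ v_r`; all other basis vectors go to `0`. -/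
def eVec (r : ℕ) (i : Fin r) : Matrix (JD r) (JD r) ℂ := (fVec r i)ᵀ

/-- `⟨h_n, wt(v_j)⟩` for `1 ≤ n, j ≤ r`, where `wt(v_j) = Λ_j - Λ_{j-1}` for `j ≠ r-1`,
`wt(v_{r-1}) = Λ_{r-1} + Λ_r - Λ_{r-2}`, and `Λ_0 = 0`. -/
def wtPos (r n j : ℕ) : ℤ :=
  if j + 1 = r then
    (if n = r then 1 else 0) + (if n + 1 = r then 1 else 0) - (if n + 2 = r then 1 else 0)
  else
    (if n = j then 1 else 0) - (if n + 1 = j then 1 else 0)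

/-- `⟨h_i, wt(v_a)⟩` for `a` in `J_D`, where `wt(v_{j̄}) = - wt(v_j)`. -/
def wtVec (r : ℕ) (i : Fin r) (a : JD r) : ℤ :=
  Int.sign (a : ℤ) * wtPos r ((i : ℕ) + 1) (a : ℤ).natAbs

/-- The basis `{(ε_1, …, ε_r)}` of `V_sp^+ ⊕ V_sp^-`, with `true` for `+` and `false` for `-`. -/
abbrev Signs (r : ℕ) : Type := Fin r → Bool

/-- `f_i` on `V_sp^+ ⊕ V_sp^-`: for `i < r` it replaces `(ε_i, ε_{i+1}) = (+,-)` by `(-,+)`;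
`f_r` replaces `(ε_{r-1}, ε_r) = (+,+)` by `(-,-)`; all other basis vectors go to `0`. -/
def fSpin (r : ℕ) (i : Fin r) : Matrix (Signs r) (Signs r) ℂ :=
  Matrix.of fun a b =>
    if (i : ℕ) + 1 < r then
      if ∀ j : Fin r,
          ((j : ℕ) = i → b j = true ∧ a j = false) ∧
          ((j : ℕ) = i + 1 → b j = false ∧ a j = true) ∧
          ((j : ℕ) ≠ i → (j : ℕ) ≠ i + 1 → a j = b j) then 1 else 0
    else
      if ∀ j : Fin r,
          ((j : ℕ) = i ∨ (j : ℕ) + 1 = i → b j = true ∧ a j = false) ∧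
          ((j : ℕ) ≠ i → (j : ℕ) + 1 ≠ i → a j = b j) then 1 else 0

/-- `e_i` on `V_sp^+ ⊕ V_sp^-`: for `i < r` it replaces `(ε_i, ε_{i+1}) = (-,+)` by `(+,-)`;
`e_r` replaces `(ε_{r-1}, ε_r) = (-,-)` by `(+,+)`; all other basis vectors go to `0`. -/
def eSpin (r : ℕ) (i : Fin r) : Matrix (Signs r) (Signs r) ℂ := (fSpin r i)ᵀ

/-- The number `ε · 1`. -/
def signVal (b : Bool) : ℤ := if b then 1 else -1

/-- The eigenvalue of `h_i` on `(ε_1, …, ε_r)`: `(ε_i - ε_{i+1}) / 2` for `i < r`, and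
`(ε_{r-1} + ε_r) / 2` for `i = r`. -/
def wtSpin (r : ℕ) (i : Fin r) (a : Signs r) : ℤ :=
  if h : (i : ℕ) + 1 < r then
    (signVal (a i) - signVal (a ⟨(i : ℕ) + 1, h⟩)) / 2
  else
    (signVal (a ⟨(i : ℕ) - 1, lt_of_le_of_lt (Nat.sub_le _ _) i.isLt⟩) + signVal (a i)) / 2

/-! ### The simply connected group

`V(Λ_1) ⊕ V_sp^+ ⊕ V_sp^-` is a faithful representation of the simply connected group `G` of type
`D_r`, and `G` is realized through it. -/

/-- The basis of `V(Λ_1) ⊕ V_sp^+ ⊕ V_sp^-`. -/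
abbrev Idx (r : ℕ) : Type := JD r ⊕ Signs r

abbrev Mat (r : ℕ) : Type := Matrix (Idx r) (Idx r) ℂ

def e (r : ℕ) (i : Fin r) : Mat r := Matrix.fromBlocks (eVec r i) 0 0 (eSpin r i)

def f (r : ℕ) (i : Fin r) : Mat r := Matrix.fromBlocks (fVec r i) 0 0 (fSpin r i)

def wt (r : ℕ) (i : Fin r) : Idx r → ℤ := Sum.elim (wtVec r i) (wtSpin r i)

/-- `exp A` as an invertible matrix. -/
def expUnit {r : ℕ} (A : Mat r) : (Mat r)ˣ where
  val := NormedSpace.exp A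
  inv := NormedSpace.exp (-A)
  val_inv := by
    rw [← Matrix.exp_add_of_commute A (-A) (Commute.neg_right (Commute.refl A)), add_neg_cancel,
      NormedSpace.exp_zero]
  inv_val := by
    rw [← Matrix.exp_add_of_commute (-A) A (Commute.neg_left (Commute.refl A)), neg_add_cancel,
      NormedSpace.exp_zero]

/-- `t ^ h_i` as an invertible matrix. -/
def torusUnit (r : ℕ) (i : Fin r) (t : ℂˣ) : (Mat r)ˣ where
  val := Matrix.diagonal fun a => ((t ^ wt r i a : ℂˣ) : ℂ)
  inv := Matrix.diagonal fun a => ((t ^ (-wt r i a) : ℂˣ) : ℂ)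
  val_inv := by
    rw [Matrix.diagonal_mul_diagonal, ← Matrix.diagonal_one]
    congr 1
    funext a
    rw [← Units.val_mul, ← zpow_add, add_neg_cancel, zpow_zero, Units.val_one]
  inv_val := by
    rw [Matrix.diagonal_mul_diagonal, ← Matrix.diagonal_one]
    congr 1
    funext a
    rw [← Units.val_mul, ← zpow_add, neg_add_cancel, zpow_zero, Units.val_one]

/-- The group `G`: it is generated by its root subgroups `exp (t e_i)`, `exp (t f_i)` and by its
maximal torus. -/
def G (r : ℕ) : Subgroup (Mat r)ˣ :=
  Subgroup.closure
    ({g | ∃ (i : Fin r) (t : ℂ), g = expUnit (t • e r i)} ∪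
     {g | ∃ (i : Fin r) (t : ℂ), g = expUnit (t • f r i)} ∪
     {g | ∃ (i : Fin r) (t : ℂˣ), g = torusUnit r i t})

/-- `x_i(t) = exp (t e_i)`. -/
def x {r : ℕ} (i : Fin r) (t : ℂ) : G r :=
  ⟨expUnit (t • e r i), Subgroup.subset_closure (Or.inl (Or.inl ⟨i, t, rfl⟩))⟩

/-- `y_i(t) = exp (t f_i)`. -/
def y {r : ℕ} (i : Fin r) (t : ℂ) : G r :=
  ⟨expUnit (t • f r i), Subgroup.subset_closure (Or.inl (Or.inr ⟨i, t, rfl⟩))⟩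

/-- `α_i^∨(t) = t ^ h_i`. -/
def coroot {r : ℕ} (i : Fin r) (t : ℂˣ) : G r :=
  ⟨torusUnit r i t, Subgroup.subset_closure (Or.inr ⟨i, t, rfl⟩)⟩

/-- The unipotent radical `N` of `B`. -/
def N (r : ℕ) : Subgroup (G r) := Subgroup.closure {g | ∃ (i : Fin r) (t : ℂ), g = x i t}

/-- The unipotent radical `N_-` of `B_-`. -/
def Nminus (r : ℕ) : Subgroup (G r) := Subgroup.closure {g | ∃ (i : Fin r) (t : ℂ), g = y i t}

/-- The element `α_1^∨(t_1) ⋯ α_r^∨(t_r)` of the maximal torus `H`. Every element of `H` has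
this form for a unique `t`, and its value under the fundamental weight `Λ_j` is `t_j`. -/
def torusElt {r : ℕ} (t : Fin r → ℂˣ) : G r := (List.ofFn fun i => coroot i (t i)).prod

/-- The representative `x_i(-1) y_i(1) x_i(-1)` of the simple reflection `s_i`. -/
def sbar {r : ℕ} (i : Fin r) : G r := x i (-1) * y i 1 * x i (-1)

/-- The representative of `u = s_{i_1} ⋯ s_{i_l}` given by a reduced word `(i_1, …, i_l)`. -/
def ubar {r : ℕ} (w : List (Fin r)) : G r := (w.map sbar).prod

/-- Regular functions on `G`: restrictions of polynomials in the matrix entries (`G` is a closed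
subgroup of the special linear group). -/
def IsRegular {r : ℕ} (Δ : G r → ℂ) : Prop :=
  ∃ P : MvPolynomial (Idx r × Idx r) ℂ,
    ∀ g : G r, Δ g = MvPolynomial.eval (fun p => ((g : (Mat r)ˣ) : Mat r) p.1 p.2) P

/-- `Δ` is the generalized minor `Δ_{uΛ_j, Λ_j}`, where `u` is given by a reduced word: the regular
function on `G` whose restriction to the open set `ū G_0`, `G_0 = N_- H N`, is
`x ↦ ([ū⁻¹ x]_0) ^ Λ_j`, where `[n₋ h n]_0 = h`. -/
def IsGeneralizedMinor {r : ℕ} (u : List (Fin r)) (j : Fin r) (Δ : G r → ℂ) : Prop :=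
  IsRegular Δ ∧
    ∀ g : G r, ∀ n₁ ∈ Nminus r, ∀ t : Fin r → ℂˣ, ∀ n₂ ∈ N r,
      (ubar u)⁻¹ * g = n₁ * torusElt t * n₂ → Δ g = (t j : ℂ)

/-- `Δ` is the minor `Δ(k; i) = Δ_{u_{≤k} Λ_{i_k}, Λ_{i_k}}`, where `u_{≤k} = s_{i_1} ⋯ s_{i_k}`.
The positions of the word `w = i` are counted from `0` here. -/
def IsInitialMinor {r n : ℕ} (w : Fin n → Fin r) (k : Fin n) (Δ : G r → ℂ) : Prop :=
  IsGeneralizedMinor ((List.ofFn w).take ((k : ℕ) + 1)) (w k) Δ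

/-- `x_{-i}(t) = y_i(t) α_i^∨(t⁻¹)`. -/
def xneg {r : ℕ} (i : Fin r) (t : ℂˣ) : G r := y i (t : ℂ) * coroot i t⁻¹

/-- `x^L_i(t_1, …, t_n) = x_{-i_1}(t_1) ⋯ x_{-i_n}(t_n)`. -/
def xL {r n : ℕ} (w : Fin n → Fin r) (t : Fin n → ℂˣ) : G r :=
  (List.ofFn fun p => xneg (w p) (t p)).prod

/-- The first `n` letters of the periodic word `1, 2, …, r, 1, 2, …, r, …`. -/
def cyclicWord {r : ℕ} (hr : 0 < r) (n : ℕ) : Fin n → Fin r :=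
  fun p => ⟨(p : ℕ) % r, Nat.mod_lt _ hr⟩

/-! ### The Laurent monomials -/

/-- The coordinate `Y_{s,j}` of
`Y = (Y_{1,1}, …, Y_{1,r}, Y_{2,1}, …, Y_{2,r}, …)`, with `Y_{s,0} = Y_{s,r+1} = 1`.
The value `1` for the pairs `(s, j)` that lie behind the end of the sequence is never used. -/
def coord (r : ℕ) {n : ℕ} (Y : Fin n → ℂˣ) (s j : ℕ) : ℂ :=
  if j = 0 ∨ j = r + 1 then 1
  else if h : (s - 1) * r + (j - 1) < n then (Y ⟨(s - 1) * r + (j - 1), h⟩ : ℂ) else 1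

/-- The Laurent monomial `D(l, a)` for a letter `a` in `J_D`. -/
def D (r : ℕ) {n : ℕ} (Y : Fin n → ℂˣ) (l : ℕ) (a : ℤ) : ℂ :=
  let j := a.natAbs
  if 0 < a then
    if j + 2 ≤ r then coord r Y l (j - 1) / coord r Y l j
    else if j + 1 = r then coord r Y l (r - 2) / (coord r Y l (r - 1) * coord r Y l r)
    else coord r Y l (r - 1) / coord r Y (l + 1) r
  else
    if j + 1 = r then coord r Y l r * coord r Y l (r - 1) / coord r Y (l + 1) (r - 2)
    else coord r Y l j / coord r Y (l + 1) (j - 1)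

/-- The number `l_i` attached to the letter `a = k_i`: it is `m - k_i + i` for `1 ≤ k_i ≤ r-1` and
`m - r + i` otherwise. (For the letters that occur below, both differences are positive.) -/
def lIndex (r m i : ℕ) (a : ℤ) : ℕ :=
  if 0 < a ∧ a < r then m + i - a.natAbs else m + i - r

/-- The condition on `(k_1, …, k_d)`; the entry `k_{i+1}` is `k i` for `i : Fin d`:
`k_1 ≱ k_2 ≱ ⋯ ≱ k_d`, and `i ≤ k_i ≤ m-1+i` for `i ≤ r-m`, and `i ≤ k_i ≤ (d-i+1)̄` for
`i > r-m`. -/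
def Admissible (r m d : ℕ) (k : Fin d → JD r) : Prop :=
  (∀ i i' : Fin d, (i' : ℕ) = i + 1 → ¬ ordLE r (k i') (k i)) ∧
  (∀ i : Fin d, (i : ℕ) + 1 ≤ r - m →
    ordLE r ((i : ℤ) + 1) (k i) ∧ ordLE r (k i) ((m : ℤ) - 1 + ((i : ℤ) + 1))) ∧
  (∀ i : Fin d, r - m < (i : ℕ) + 1 →
    ordLE r ((i : ℤ) + 1) (k i) ∧ ordLE r (k i) (-((d : ℤ) - ((i : ℤ) + 1) + 1)))

end

end TypeD

/-!
The group acts on the vector representation, with basis `v_1, …, v_r, v_{r̄}, …, v_{1̄}`. As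
`d ≤ r - 2`, the vector `v_1 ∧ ⋯ ∧ v_d` of the `d`-th exterior power has weight `Λ_d` and is fixed by
`N`, so the leading principal minor of size `d` of `ū⁻¹ g` has the defining property of the
generalized minor (`isGeneralizedMinor_leadingMinor`). The property determines the function, because
`N_- H N` is dense (`regular_ext`): a product `x_i(s) g` with `g` in the cell leaves the cell for
only finitely many `s`, by the Gauss decomposition in `SL₂`, and a regular function of it is a
polynomial in `s`. The relations used here hold in the given matrices because a generator `e_i` or
`f_i` has square zero and is a partial permutation of the basis.

It remains to compute a minor of `ū⁻¹ x^L(Y)`. Multiplication of a row vector by the factors of one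
cycle `1, …, r` is explicit (`rowStep_cycle_full`), and in terms of the monomials `D` it is a
summation over one more letter of a chain `k_{n-1} ≤ ⋯ ≤ k_i` in `J_D` (`IsChainRow.step`). The rows
of `ū⁻¹` are, up to signs, unit rows at the upper bounds `m - 1 + i` and `1̄, 2̄, …` of the
inequalities for `k_i` (`row_unitRow_vecMul_ubar`); the signs cancel the sign of the permutation that
sorts them (`sign_reverseFrom`). So the minor is a determinant of chain sums, in which the rows that
belong to barred letters start at the index `r - m + 1` instead of their own. Subtracting
neighbouring rows repairs this, and the factors that come out telescope
(`det_truncatedChainMatrix_zero`). The result is a Hessenberg determinant with ones below the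
diagonal, whose entry in row `i` and column `b` is the sum over the chains
`b ≤ k_b ≤ ⋯ ≤ k_i ≤ E_i`. The expansion of such a determinant is an inclusion–exclusion that turns
the relations `≤` between neighbours into `≱`, so it is the sum over the tuples
`k_1 ≱ k_2 ≱ ⋯ ≱ k_d` with `i ≤ k_i ≤ E_i` (`det_chainEntry`).
-/

namespace TypeD

noncomputable section

/-! ### Chain sums -/

theorem ordLE.trans {r : ℕ} {a b c : ℤ} (h : ordLE r a b) (h' : ordLE r b c) : ordLE r a c := by
  unfold ordLE at *
  rcases h with rfl | h
  · exact h'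
  · rcases h' with rfl | h'
    · exact Or.inr h
    · exact Or.inr (h.trans h')

theorem ordLE.refl {r : ℕ} (a : ℤ) : ordLE r a a := Or.inl rfl

open Classical in
/-- The sum of the products `F i k_i ⋯ F (n-1) k_{n-1}` over all chains
`t ≤ k_{n-1} ≤ ⋯ ≤ k_i ≤ e` in `J_D`. For `n = i` the chain is empty and the value is `1` or `0`
according to whether `t ≤ e`; for `n < i` it is `0`. -/
def chainSum (r : ℕ) (F : ℕ → ℤ → ℂ) (e : ℤ) (i : ℕ) : ℕ → ℤ → ℂ
  | 0, t => if i = 0 ∧ ordLE r t e then 1 else 0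
  | n + 1, t =>
    if n + 1 < i then 0
    else if n + 1 = i then (if ordLE r t e then 1 else 0)
    else ∑ k : JD r, if ordLE r t k then F n k * chainSum r F e i n k else 0

theorem JD.bounds {r : ℕ} (a : JD r) : (a : ℤ) ≠ 0 ∧ -(r : ℤ) ≤ a ∧ (a : ℤ) ≤ r := by
  have := a.2
  simp only [Finset.mem_erase, Finset.mem_Icc] at this
  exact this

theorem exists_JD {r : ℕ} {z : ℤ} (h1 : z ≠ 0) (h2 : -(r : ℤ) ≤ z) (h3 : z ≤ r) :
    ∃ b : JD r, (b : ℤ) = z :=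
  ⟨⟨z, by simp [h1, h2, h3]⟩, rfl⟩

section
variable {r : ℕ} {F : ℕ → ℤ → ℂ} {e : ℤ} {i : ℕ}

theorem chainSum_of_lt {n : ℕ} (h : n < i) (t : ℤ) : chainSum r F e i n t = 0 := by
  cases n with
  | zero => rw [chainSum, if_neg (by omega)]
  | succ n => rw [chainSum, if_pos h]

open Classical in
theorem chainSum_self (t : ℤ) : chainSum r F e i i t = if ordLE r t e then 1 else 0 := by
  cases i with
  | zero => simp [chainSum]
  | succ n => rw [chainSum, if_neg (by omega), if_pos rfl]

open Classical in
theorem chainSum_succ {n : ℕ} (h : i ≤ n) (t : ℤ) : chainSum r F e i (n + 1) t =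
    ∑ k : JD r, if ordLE r t k then F n k * chainSum r F e i n k else 0 := by
  rw [chainSum, if_neg (by omega), if_neg (by omega)]

theorem chainSum_eq_zero {n : ℕ} {t : ℤ} (h : ¬ ordLE r t e) : chainSum r F e i n t = 0 := by
  induction n generalizing t with
  | zero => rw [chainSum, if_neg (fun h' => h h'.2)]
  | succ n ih =>
    rw [chainSum]
    split_ifs
    · rfl
    · rfl
    · refine Finset.sum_eq_zero fun k _ => ?_
      split_ifs with hk
      · rw [ih (fun h' => h (hk.trans h')), mul_zero]
      · rfl

/-- Raising the upper bound from `e'` to the next letter `e` adds the chains with `k_j = e`. -/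
theorem chainSum_sub_chainSum {e' : ℤ} {j : ℕ} (he : ∃ k : JD r, (k : ℤ) = e)
    (h1 : ∀ k : JD r, ordLE r k e ↔ ordLE r k e' ∨ (k : ℤ) = e) (h2 : ¬ ordLE r e e')
    {n : ℕ} (hn : j < n) (t : ℤ) :
    chainSum r F e j n t - chainSum r F e' j n t = F j e * chainSum r F e (j + 1) n t := by
  classical
  induction n, hn using Nat.le_induction generalizing t with
  | base =>
    rw [Nat.succ_eq_add_one, chainSum_succ le_rfl, chainSum_succ le_rfl, chainSum_self,
      ← Finset.sum_sub_distrib]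
    obtain ⟨k, hk⟩ := he
    rw [Finset.sum_eq_single k]
    · rw [chainSum_self, chainSum_self, hk, if_pos (ordLE.refl e), if_neg h2]
      split_ifs <;> simp
    · intro b _ hb
      have hbe : (b : ℤ) ≠ e := fun h => hb (Subtype.ext (h.trans hk.symm))
      rw [chainSum_self, chainSum_self]
      have : ordLE r b e ↔ ordLE r b e' := by rw [h1]; simp [hbe]
      simp only [this, sub_self]
    · simp
  | succ n hn ih =>
    have hn' : j + 1 ≤ n := hn
    rw [chainSum_succ (by omega), chainSum_succ (by omega), chainSum_succ hn',
      ← Finset.sum_sub_distrib, Finset.mul_sum]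
    refine Finset.sum_congr rfl fun k _ => ?_
    split_ifs
    · rw [← mul_sub, ih]
      ring
    · simp

end

/-! ### Hessenberg determinants -/

/-- The determinant of the matrix of size `n + 1` with last column `u` whose other columns are those
of the Hessenberg matrix `H` with entries `1` below the diagonal, as a function of `u`. The recursion
is the expansion along the last row, in which only the last two entries, `1` and `u (n + 1)`, are
not zero. -/
def hessenbergFunctional (H : ℕ → ℕ → ℂ) : ℕ → (ℕ → ℂ) →ₗ[ℂ] ℂ
  | 0 => LinearMap.proj 0
  | n + 1 => (hessenbergFunctional H n).comp
      ((LinearMap.proj (n + 1)).smulRight (fun i => H i n) - LinearMap.id)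

theorem hessenbergFunctional_succ (H : ℕ → ℕ → ℂ) (n : ℕ) (u : ℕ → ℂ) :
    hessenbergFunctional H (n + 1) u =
      hessenbergFunctional H n fun i => u (n + 1) * H i n - u i := rfl

theorem hessenbergFunctional_congr (H : ℕ → ℕ → ℂ) (n : ℕ) {u v : ℕ → ℂ}
    (h : ∀ i ≤ n, u i = v i) : hessenbergFunctional H n u = hessenbergFunctional H n v := by
  induction n generalizing u v with
  | zero => exact h 0 le_rfl
  | succ n ih =>
    rw [hessenbergFunctional_succ, hessenbergFunctional_succ]
    exact ih fun i hi => by rw [h _ le_rfl, h i (by omega)]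

/-- The columns and rows are counted from `0`, so that `H (b + 1) b` is the entry below the
diagonal. -/
theorem det_eq_hessenbergFunctional (H : ℕ → ℕ → ℂ) (h0 : ∀ i b, b + 1 < i → H i b = 0)
    (n : ℕ) (h1 : ∀ b < n, H (b + 1) b = 1) (u : ℕ → ℂ) :
    (Matrix.of fun i b : Fin (n + 1) => if (b : ℕ) = n then u i else H i b).det =
      hessenbergFunctional H n u := by
  induction n generalizing u with
  | zero =>
    rw [Matrix.det_fin_one]
    rfl
  | succ n ih =>
    rw [Matrix.det_succ_row _ (Fin.last (n + 1)), Fin.sum_univ_castSucc, Fin.sum_univ_castSucc,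
      Finset.sum_eq_zero, hessenbergFunctional_succ]
    · have e1 : (fun i => u (n + 1) * H i n - u i) = u (n + 1) • (fun i => H i n) - u := rfl
      have h1' : ∀ b < n, H (b + 1) b = 1 := fun b hb => h1 b (by omega)
      rw [e1, map_sub, map_smul, ← ih h1', ← ih h1', zero_add]
      have s1 : ((-1 : ℂ)) ^ (n + 1 + n) = -1 := Odd.neg_one_pow ⟨n, by ring⟩
      have s2 : ((-1 : ℂ)) ^ (n + 1 + (n + 1)) = 1 := Even.neg_one_pow ⟨n + 1, rfl⟩
      simp only [Fin.val_last, Fin.val_castSucc, Matrix.of_apply, s1, s2, smul_eq_mul]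
      rw [if_neg (by omega), if_pos trivial, h1 n (by omega)]
      have m1 : (Matrix.of fun i b : Fin (n + 1 + 1) =>
          if (b : ℕ) = n + 1 then u i else H i b).submatrix
          (Fin.last (n + 1)).succAbove (Fin.last n).castSucc.succAbove =
          Matrix.of fun i b : Fin (n + 1) => if (b : ℕ) = n then u i else H i b := by
        ext i b
        simp only [Matrix.submatrix_apply, Matrix.of_apply, Fin.succAbove_last, Fin.val_castSucc]
        rcases Fin.eq_castSucc_or_eq_last b with ⟨b, rfl⟩ | rfl
        · rw [Fin.succAbove_of_castSucc_lt _ _ (by simp [Fin.lt_def])]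
          have := b.2
          simp only [Fin.val_castSucc]
          rw [if_neg (by omega), if_neg (by omega)]
        · rw [Fin.succAbove_castSucc_self]
          simp
      have m2 : (Matrix.of fun i b : Fin (n + 1 + 1) =>
          if (b : ℕ) = n + 1 then u i else H i b).submatrix
          (Fin.last (n + 1)).succAbove (Fin.last (n + 1)).succAbove =
          Matrix.of fun i b : Fin (n + 1) => if (b : ℕ) = n then H i n else H i b := by
        ext i b
        have := b.2
        simp only [Matrix.submatrix_apply, Matrix.of_apply, Fin.succAbove_last, Fin.val_castSucc]
        rw [if_neg (by omega)]
        split_ifs with h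
        · rw [h]
        · rfl
      rw [m1, m2]
      ring
    · intro b _
      have := b.2
      simp only [Fin.val_last, Fin.val_castSucc, Matrix.of_apply]
      rw [if_neg (by omega), h0 _ _ (by omega)]
      simp

/-! ### Sums over antichains -/

/-- The tuples `k_1 ≱ k_2 ≱ ⋯ ≱ k_n` with `i ≤ k_i ≤ E i`; the entry `k_{i+1}` is `κ i`. -/
def BoundedAntichain (r : ℕ) (E : ℕ → ℤ) (n : ℕ) (κ : Fin n → JD r) : Prop :=
  (∀ i i' : Fin n, (i' : ℕ) = i + 1 → ¬ ordLE r (κ i') (κ i)) ∧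
    ∀ i : Fin n, ordLE r ((i : ℤ) + 1) (κ i) ∧ ordLE r (κ i) (E (i + 1))

theorem boundedAntichain_snoc {r : ℕ} {E : ℕ → ℤ} {n : ℕ} (κ : Fin n → JD r) (k : JD r) :
    BoundedAntichain r E (n + 1) (Fin.snoc κ k) ↔
      (ordLE r ((n : ℤ) + 1) k ∧ ordLE r k (E (n + 1))) ∧
      BoundedAntichain r E n κ ∧ ∀ i : Fin n, (i : ℕ) + 1 = n → ¬ ordLE r k (κ i) := by
  unfold BoundedAntichain
  simp only [Fin.forall_fin_succ', Fin.snoc_castSucc, Fin.snoc_last, Fin.val_castSucc, Fin.val_last]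
  constructor
  · rintro ⟨⟨h1, h2⟩, h3, h4⟩
    exact ⟨h4, ⟨fun i => (h1 i).1, h3⟩, fun i hi => (h1 i).2 hi.symm⟩
  · rintro ⟨h4, ⟨h1, h3⟩, h2⟩
    exact ⟨⟨fun i => ⟨h1 i, fun hi => h2 i hi.symm⟩, fun i hi => by have := i.2; omega,
      fun h => by omega⟩, h3, h4⟩

section
variable {r : ℕ} {E : ℕ → ℤ} {F : ℕ → ℤ → ℂ}

open Classical in
/-- Summation over the last entry `k` of the tuple first. -/
theorem sum_boundedAntichain_snoc {n : ℕ} (P : (Fin (n + 1) → JD r) → Prop) :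
    ∑ κ : Fin (n + 1) → JD r with BoundedAntichain r E (n + 1) κ ∧ P κ,
      ∏ i : Fin (n + 1), F (i + 1) (κ i) =
    ∑ k : JD r, if ordLE r ((n : ℤ) + 1) k ∧ ordLE r k (E (n + 1)) then
      F (n + 1) k * ∑ κ : Fin n → JD r with
        BoundedAntichain r E n κ ∧ (∀ i : Fin n, (i : ℕ) + 1 = n → ¬ ordLE r k (κ i)) ∧
          P (Fin.snoc κ k), ∏ i : Fin n, F (i + 1) (κ i) else 0 := by
  simp only [Finset.sum_filter]
  rw [← (Fin.snocEquiv (fun _ => JD r)).sum_comp, Fintype.sum_prod_type]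
  refine Finset.sum_congr rfl fun k _ => ?_
  simp only [Fin.snocEquiv_apply]
  by_cases h : ordLE r ((n : ℤ) + 1) k ∧ ordLE r k (E (n + 1))
  · rw [if_pos h, Finset.mul_sum]
    refine Finset.sum_congr rfl fun κ _ => ?_
    rw [Fin.prod_univ_castSucc]
    simp only [Fin.snoc_castSucc, Fin.snoc_last, Fin.val_castSucc, Fin.val_last, mul_ite, mul_zero]
    refine if_congr ?_ (mul_comm _ _) rfl
    change BoundedAntichain r E (n + 1) (Fin.snoc κ k) ∧ P (Fin.snoc κ k) ↔ _
    rw [boundedAntichain_snoc]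
    tauto
  · rw [if_neg h]
    refine Finset.sum_eq_zero fun κ _ => ?_
    rw [if_neg]
    rintro ⟨h', -⟩
    exact h ((boundedAntichain_snoc κ k).1 h').1

/-- The matrix entries that turn a sum over antichains into a Hessenberg determinant. With rows and
columns counted from `1`, the entry in row `i` and column `b` is the sum over the chains
`b ≤ k_b ≤ ⋯ ≤ k_i ≤ E i`. -/
def chainEntry (r : ℕ) (F : ℕ → ℤ → ℂ) (E : ℕ → ℤ) (i b : ℕ) : ℂ :=
  chainSum r F (E (i + 1)) (i + 1) (b + 2) ((b : ℤ) + 1)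

open Classical in
/-- If the last column consists of the chain sums with lower end `t` (and `t` is within the bounds
for the entry `k_{n+1}`), the determinant is the sum over the antichains `k_1 ≱ ⋯ ≱ k_n` that can be
continued by `t`. The step: subtracting this column from the one with lower end `n + 1` leaves the
chains whose least letter `k` satisfies `k ≱ t`. -/
theorem hessenbergFunctional_chainSum (hE : ∀ i j, i ≤ j → ordLE r (E i) (E j)) (n : ℕ) (t : ℤ)
    (ht : ordLE r ((n : ℤ) + 1) t) (ht' : ordLE r t (E (n + 1))) :
    hessenbergFunctional (chainEntry r F E) n
      (fun i => chainSum r F (E (i + 1)) (i + 1) (n + 1) t) =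
    ∑ κ : Fin n → JD r with
        BoundedAntichain r E n κ ∧ (∀ i : Fin n, (i : ℕ) + 1 = n → ¬ ordLE r t (κ i)),
      ∏ i : Fin n, F (i + 1) (κ i) := by
  induction n generalizing t with
  | zero =>
    change chainSum r F (E 1) 1 1 t = _
    rw [chainSum_self, if_pos ht']
    simp [BoundedAntichain]
  | succ n ih =>
    rw [hessenbergFunctional_succ]
    refine Eq.trans ?_ ((sum_boundedAntichain_snoc (E := E) (F := F) (fun κ : Fin (n + 1) → JD r =>
      ∀ i : Fin (n + 1), (i : ℕ) + 1 = n + 1 → ¬ ordLE r t (κ i))).symm.trans (by congr!))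
    have h1 : ordLE r ((n : ℤ) + 1) t := by
      refine ordLE.trans (Or.inr ?_) ht
      unfold height
      push_cast
      split_ifs <;> omega
    have hP : ∀ (κ : Fin n → JD r) (k : JD r), (∀ i : Fin (n + 1), (i : ℕ) + 1 = n + 1 →
        ¬ ordLE r t ((Fin.snoc κ k : Fin (n + 1) → JD r) i)) ↔ ¬ ordLE r t k := fun κ k => by
      rw [Fin.forall_fin_succ']
      simp only [Fin.snoc_castSucc, Fin.snoc_last, Fin.val_castSucc, Fin.val_last, forall_const,
        and_iff_right_iff_imp]
      intro _ i hi
      have := i.2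
      omega
    simp only [hP]
    rw [hessenbergFunctional_congr (v := ∑ k : JD r,
      (if ordLE r ((n : ℤ) + 1) k ∧ ¬ ordLE r t k then F (n + 1) k else 0) •
        fun i => chainSum r F (E (i + 1)) (i + 1) (n + 1) k), map_sum]
    · refine Finset.sum_congr rfl fun k _ => ?_
      rw [map_smul]
      by_cases hk : ordLE r ((n : ℤ) + 1) k
      · by_cases hk' : ordLE r k (E (n + 1))
        · rw [ih k hk hk']
          by_cases hkt : ordLE r t k <;> simp [hk, hk', hkt]
        · simp only [hk', and_false, if_false]
          rw [hessenbergFunctional_congr (v := 0), map_zero, smul_zero]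
          intro i hi
          exact chainSum_eq_zero fun h => hk' (h.trans (hE _ _ (by omega)))
      · rw [if_neg (fun h => hk h.1), if_neg (fun h => hk h.1), zero_smul]
    · intro i hi
      rw [chainSum_self, if_pos ht', one_mul, chainEntry, chainSum_succ (by omega),
        chainSum_succ (by omega), ← Finset.sum_sub_distrib, Finset.sum_apply]
      refine Finset.sum_congr rfl fun k _ => ?_
      simp only [Pi.smul_apply, smul_eq_mul]
      by_cases hk : ordLE r t k
      · rw [if_pos hk, if_pos (h1.trans hk), if_neg (fun h => h.2 hk)]
        simp
      · by_cases hk' : ordLE r ((n : ℤ) + 1) k <;> simp [hk, hk']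

open Classical in
/-- A sum over antichains as a Hessenberg determinant. -/
theorem det_chainEntry (hE : ∀ i j, i ≤ j → ordLE r (E i) (E j))
    (n : ℕ) (hn : ∀ b < n, ordLE r ((b : ℤ) + 1) (E (b + 2))) :
    (Matrix.of fun i b : Fin (n + 1) => chainEntry r F E i b).det =
    ∑ κ : Fin (n + 1) → JD r with BoundedAntichain r E (n + 1) κ,
      ∏ i : Fin (n + 1), F (i + 1) (κ i) := by
  have h := det_eq_hessenbergFunctional (chainEntry r F E)
    (fun i b hb => chainSum_of_lt (by omega) _) n
    (fun b hb => by rw [chainEntry, chainSum_self, if_pos (hn b hb)]) (fun i => chainEntry r F E i n)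
  have h2 : (Matrix.of fun i b : Fin (n + 1) => chainEntry r F E i b) =
      Matrix.of fun i b : Fin (n + 1) => if (b : ℕ) = n then chainEntry r F E i n
        else chainEntry r F E i b := by
    ext i b
    simp only [Matrix.of_apply]
    split_ifs with hb
    · rw [hb]
    · rfl
  rw [h2, h]
  refine Eq.trans ?_ ((sum_boundedAntichain_snoc (E := E) (F := F)
    (fun κ : Fin (n + 1) → JD r => True)).symm.trans (by simp only [and_true]))
  simp only [and_true]
  rw [hessenbergFunctional_congr (v := ∑ k : JD r,
    (if ordLE r ((n : ℤ) + 1) k then F (n + 1) k else 0) •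
      fun i => chainSum r F (E (i + 1)) (i + 1) (n + 1) k), map_sum]
  · refine Finset.sum_congr rfl fun k _ => ?_
    rw [map_smul]
    by_cases hk : ordLE r ((n : ℤ) + 1) k
    · by_cases hk' : ordLE r k (E (n + 1))
      · rw [hessenbergFunctional_chainSum hE n k hk hk']
        simp [hk, hk']
      · simp only [hk', and_false, if_false]
        rw [hessenbergFunctional_congr (v := 0), map_zero, smul_zero]
        intro i hi
        exact chainSum_eq_zero fun h => hk' (h.trans (hE _ _ (by omega)))
    · rw [if_neg hk, if_neg (fun h => hk h.1), zero_smul]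
  · intro i hi
    rw [chainEntry, chainSum_succ (by omega), Finset.sum_apply]
    refine Finset.sum_congr rfl fun k _ => ?_
    simp only [Pi.smul_apply, smul_eq_mul]
    split_ifs <;> simp

end

/-! ### Row reduction to Hessenberg form -/

/-- The upper bound for `k_j`: the letter `m - 1 + j` for `j ≤ r - m`, and the letter
`(d - j + 1)̄` for `r - m < j ≤ d`. -/
def upperBound (r m d j : ℕ) : ℤ :=
  if j ≤ r - m then (m : ℤ) - 1 + j else -(((d - j : ℕ) : ℤ) + 1)

section
variable {r m d : ℕ}

theorem upperBound_mono (hdr : d < r - 1) (hm : 2 ≤ m) (hmr : m ≤ r - 1) (i j : ℕ) (hij : i ≤ j) :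
    ordLE r (upperBound r m d i) (upperBound r m d j) := by
  have hj' : j ≤ r - m → i ≤ r - m := fun h => hij.trans h
  by_cases hi : i ≤ r - m <;> by_cases hj : j ≤ r - m <;>
    simp only [upperBound, hi, hj, if_true, if_false] <;> unfold ordLE height <;>
    split_ifs <;> omega

theorem le_upperBound (hdr : d < r - 1) (hm : 2 ≤ m) (hmr : m ≤ r - 1) (b j : ℕ) (hb0 : 1 ≤ b)
    (hb : b ≤ j) (hbd : b ≤ d) : ordLE r (b : ℤ) (upperBound r m d j) := by
  by_cases hj : j ≤ r - m <;>
    simp only [upperBound, hj, if_true, if_false] <;> unfold ordLE height <;>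
    split_ifs <;> omega

theorem admissible_iff (κ : Fin d → JD r) :
    Admissible r m d κ ↔ BoundedAntichain r (upperBound r m d) d κ := by
  unfold Admissible BoundedAntichain
  refine and_congr_right fun _ => ⟨fun ⟨h1, h2⟩ i => ?_, fun h => ⟨fun i hi => ?_, fun i hi => ?_⟩⟩
  · have := i.2
    unfold upperBound
    split_ifs with hi
    · simpa using h1 i hi
    · have := h2 i (by omega)
      rwa [show -((d : ℤ) - ((i : ℤ) + 1) + 1) = -(((d - (i + 1) : ℕ) : ℤ) + 1) by omega] at this
  · have := h i
    rw [upperBound, if_pos hi] at this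
    simpa using this
  · have h' := h i
    have := i.2
    rw [upperBound, if_neg (by omega)] at h'
    rwa [show -((d : ℤ) - ((i : ℤ) + 1) + 1) = -(((d - (i + 1) : ℕ) : ℤ) + 1) by omega]

/-- The matrix of chain sums in which the `i`-th row starts at index `i` or at index
`r - m + s + 1`, whichever is smaller. -/
def truncatedChainMatrix (r m d : ℕ) (F : ℕ → ℤ → ℂ) (s : ℕ) : Matrix (Fin d) (Fin d) ℂ :=
  Matrix.of fun i b => chainSum r F (upperBound r m d (i + 1)) (min ((i : ℕ) + 1) (r - m + s + 1))
    ((b : ℕ) + 2) ((b : ℤ) + 1)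

/-- Subtracting from each row below `r - m + s + 1` the preceding one raises the index at which it
starts and takes out the weight of its upper bound, because consecutive upper bounds are consecutive
letters `j̄`. -/
theorem det_truncatedChainMatrix (F : ℕ → ℤ → ℂ) (hdr : d < r - 1) (hm : 2 ≤ m) (hmr : m ≤ r - 1)
    (s : ℕ) : (truncatedChainMatrix r m d F s).det =
      (∏ i : Fin d, if r - m + s + 1 < (i : ℕ) + 1 then
        F (r - m + s + 1) (upperBound r m d (i + 1)) else 1) *
      (truncatedChainMatrix r m d F (s + 1)).det := by
  rw [← Matrix.det_mul_column]
  cases d with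
  | zero => simp
  | succ n =>
    refine Matrix.det_eq_of_forall_row_eq_smul_add_pred
      (fun i : Fin n => if r - m + s + 1 < (i : ℕ) + 2 then 1 else 0) (fun j => ?_) (fun i j => ?_)
    · simp [truncatedChainMatrix]
    · have hi := i.2
      have hj := j.2
      simp only [truncatedChainMatrix, Matrix.of_apply, Fin.val_succ, Fin.val_castSucc]
      by_cases h : r - m + s + 1 < (i : ℕ) + 1 + 1
      · rw [if_pos h, if_pos h, one_mul, ← sub_eq_iff_eq_add]
        rw [min_eq_right (by omega), min_eq_right (by omega), min_eq_right (by omega)]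
        have hE : upperBound r m (n + 1) (i + 1 + 1) = -(((n - (i + 1) : ℕ) : ℤ) + 1) := by
          rw [upperBound, if_neg (by omega)]
          omega
        have hE' : upperBound r m (n + 1) (i + 1) = -(((n - (i + 1) : ℕ) : ℤ) + 2) := by
          rw [upperBound, if_neg (by omega)]
          omega
        rcases Nat.lt_or_ge (r - m + s + 1) ((j : ℕ) + 2) with hjn | hjn
        · refine chainSum_sub_chainSum ⟨⟨upperBound r m (n + 1) (i + 1 + 1), ?_⟩, rfl⟩
            (fun k => ?_) ?_ hjn _
          · rw [hE]
            simp only [Finset.mem_erase, Finset.mem_Icc]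
            omega
          · have hk := k.bounds
            simp only [hE, hE']
            unfold ordLE height
            split_ifs <;> omega
          · simp only [hE, hE']
            unfold ordLE height
            split_ifs <;> omega
        · have hle : ∀ i', (j : ℕ) + 1 ≤ i' →
              ordLE r ((j : ℤ) + 1) (upperBound r m (n + 1) i') := fun i' hi' => by
            exact_mod_cast le_upperBound hdr hm hmr (j + 1) i' (by omega) hi' (by omega)
          rw [chainSum_of_lt (i := r - m + (s + 1) + 1) (by omega), mul_zero]
          rcases hjn.lt_or_eq with hjn | hjn
          · rw [chainSum_of_lt hjn, chainSum_of_lt hjn, sub_zero]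
          · rw [hjn, chainSum_self, chainSum_self, if_pos (hle _ (by omega)),
              if_pos (hle _ (by omega)), sub_self]
      · rw [if_neg h, if_neg (by omega), zero_mul, add_zero, one_mul, min_eq_left (by omega),
          min_eq_left (by omega)]

theorem prod_upperBound (g : ℤ → ℂ) (d a : ℕ) (ha : r - m ≤ a) :
    (∏ i : Fin d, if a < (i : ℕ) + 1 then g (upperBound r m d (i + 1)) else 1) =
      ∏ j ∈ Finset.range (d - a), g (-((j : ℤ) + 1)) := by
  rw [← Equiv.prod_comp Fin.revPerm]
  simp only [Fin.revPerm_apply, Fin.val_rev]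
  have h : ∀ i : Fin d, (if a < d - ((i : ℕ) + 1) + 1 then
      g (upperBound r m d (d - ((i : ℕ) + 1) + 1)) else 1) =
      if (i : ℕ) ∈ Finset.range (d - a) then g (-((i : ℤ) + 1)) else 1 := fun i => by
    have := i.2
    simp only [Finset.mem_range]
    by_cases h : a < d - ((i : ℕ) + 1) + 1
    · rw [if_pos h, if_pos (by omega), upperBound, if_neg (by omega)]
      congr 1
      omega
    · rw [if_neg h, if_neg (by omega)]
  simp only [h]
  rw [Fin.prod_univ_eq_prod_range
    (fun i => if i ∈ Finset.range (d - a) then g (-((i : ℤ) + 1)) else 1) d,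
    Finset.prod_ite_mem, Finset.inter_eq_right.2 (Finset.range_mono (by omega))]

/-- The row reduction that turns the matrix of chain sums starting at `r - m + 1` into the
Hessenberg matrix. The row scalars `(c 1 j)⁻¹` are absorbed by the factors `F (r - m + s + 1) (j̄)`
of the successive reductions, which telescope. -/
theorem det_truncatedChainMatrix_zero (F : ℕ → ℤ → ℂ) (c : ℕ → ℕ → ℂ) (hdr : d < r - 1)
    (hm : 2 ≤ m) (hmr : m ≤ r - 1) (hc : ∀ s j, c s j ≠ 0) (hc0 : ∀ s, c s 0 = 1)
    (hF : ∀ s j, j < d → F (r - m + s + 1) (-((j : ℤ) + 1)) = c (s + 1) (j + 1) / c (s + 2) j) :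
    (Matrix.of fun i b : Fin d => (if r - m < (i : ℕ) + 1 then (c 1 (d - (i + 1)))⁻¹ else 1) *
      chainSum r F (upperBound r m d (i + 1)) (min ((i : ℕ) + 1) (r - m + 1))
        ((b : ℕ) + 2) ((b : ℤ) + 1)).det =
    (Matrix.of fun i b : Fin d => chainEntry r F (upperBound r m d) i b).det := by
  have key : ∀ s, s ≤ d - (r - m) →
      (∏ j ∈ Finset.range (d - (r - m)), (c 1 j)⁻¹) * (truncatedChainMatrix r m d F 0).det =
      (∏ j ∈ Finset.range (d - (r - m) - s), (c (s + 1) j)⁻¹) *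
        (truncatedChainMatrix r m d F s).det := by
    intro s hs
    induction s with
    | zero => rfl
    | succ s ih =>
      rw [ih (by omega), det_truncatedChainMatrix F hdr hm hmr,
        prod_upperBound (g := F (r - m + s + 1)) d _ (by omega), ← mul_assoc]
      congr 1
      rw [show d - (r - m + s + 1) = d - (r - m) - (s + 1) by omega,
        show d - (r - m) - s = d - (r - m) - (s + 1) + 1 by omega, Finset.prod_range_succ', hc0,
        inv_one, mul_one, ← Finset.prod_mul_distrib]
      refine Finset.prod_congr rfl fun j hj => ?_
      rw [hF s j (by rw [Finset.mem_range] at hj; omega)]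
      have := hc (s + 1) (j + 1)
      field_simp
  have h0 : (Matrix.of fun i b : Fin d =>
      (if r - m < (i : ℕ) + 1 then (c 1 (d - (i + 1)))⁻¹ else 1) *
      chainSum r F (upperBound r m d (i + 1)) (min ((i : ℕ) + 1) (r - m + 1))
        ((b : ℕ) + 2) ((b : ℤ) + 1)).det =
      (∏ j ∈ Finset.range (d - (r - m)), (c 1 j)⁻¹) * (truncatedChainMatrix r m d F 0).det := by
    have h1 := prod_upperBound (r := r) (m := m) (fun z => (c 1 (-z - 1).toNat)⁻¹) d _ le_rfl
    have h2 : ∀ j : ℕ, (- -((j : ℤ) + 1) - 1).toNat = j := fun j => by omega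
    simp only [h2] at h1
    rw [← h1]
    refine Eq.trans ?_ (Matrix.det_mul_column _ _)
    congr 1
    ext i b
    simp only [Matrix.of_apply, truncatedChainMatrix]
    split_ifs with h
    · rw [upperBound, if_neg (by omega)]
      congr 4
      omega
    · rfl
  rw [h0, key _ le_rfl, Nat.sub_self, Finset.prod_range_zero, one_mul]
  congr 1
  ext i b
  have := i.2
  simp only [Matrix.of_apply, truncatedChainMatrix, chainEntry]
  rw [min_eq_left (by omega)]

end

/-! ### Basis vectors and weights of the representations -/

/-- `f_{i+1}` sends the basis vector `v_b` of the vector representation to `v_a`. -/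
def vecRel (r : ℕ) (i : Fin r) (b a : ℤ) : Prop :=
  if (i : ℤ) + 1 < r then
    (b = (i : ℤ) + 1 ∧ a = (i : ℤ) + 2) ∨ (b = -((i : ℤ) + 2) ∧ a = -((i : ℤ) + 1))
  else (b = r ∧ a = -((r : ℤ) - 1)) ∨ (b = (r : ℤ) - 1 ∧ a = -(r : ℤ))

/-- The signs that `f_{i+1}` can change are those at the positions `j` with `spinSupp r i j`. -/
def spinSupp (r : ℕ) (i : Fin r) (j : Fin r) : Prop :=
  if (i : ℕ) + 1 < r then (j : ℕ) = i ∨ (j : ℕ) = i + 1 else (j : ℕ) = i ∨ (j : ℕ) + 1 = i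

/-- The sign at the position `j` of `spinSupp` that a basis vector must have for `f_{i+1}` not to
send it to `0`; the image has the opposite sign there. -/
def spinPat (r : ℕ) (i : Fin r) (j : Fin r) : Bool :=
  if (i : ℕ) + 1 < r then decide ((j : ℕ) = i) else true

/-- `f_{i+1}` sends the basis vector `b` of the spin representations to `a`. -/
def spinRel (r : ℕ) (i : Fin r) (b a : Signs r) : Prop :=
  ∀ j, (spinSupp r i j → b j = spinPat r i j ∧ a j = !spinPat r i j) ∧
    (¬ spinSupp r i j → a j = b j)

/-- `f_{i+1}` sends the basis vector `b` to the basis vector `a`, and equivalently `e_{i+1}` sends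
`a` to `b`. -/
def rel (r : ℕ) (i : Fin r) : Idx r → Idx r → Prop
  | .inl b, .inl a => vecRel r i b a
  | .inr b, .inr a => spinRel r i b a
  | _, _ => False

open Classical in
theorem fVec_apply {r : ℕ} (i : Fin r) (a b : JD r) :
    fVec r i a b = if vecRel r i b a then 1 else 0 := by
  have := i.2
  simp only [fVec, vecRel, Matrix.of_apply]
  by_cases h : (i : ℤ) + 1 < r
  · simp only [h, if_true]
    exact if_congr (by constructor <;> rintro (h | h) <;> omega) rfl rfl
  · simp only [h, if_false]
    exact if_congr (by constructor <;> rintro (h | h) <;> omega) rfl rfl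

open Classical in
theorem fSpin_apply {r : ℕ} (i : Fin r) (a b : Signs r) :
    fSpin r i a b = if spinRel r i b a then 1 else 0 := by
  have := i.2
  simp only [fSpin, spinRel, Matrix.of_apply, spinSupp, spinPat]
  by_cases h : (i : ℕ) + 1 < r
  · simp only [h, if_true]
    refine if_congr (forall_congr' fun j => ?_) rfl rfl
    by_cases h1 : (j : ℕ) = i
    · simp [h1]
    · by_cases h2 : (j : ℕ) = i + 1 <;> simp [h1, h2]
  · simp only [h, if_false]
    refine if_congr (forall_congr' fun j => ?_) rfl rfl
    by_cases h1 : (j : ℕ) = i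
    · simp [h1]
    · by_cases h2 : (j : ℕ) + 1 = i <;> simp [h1, h2]

open Classical in
theorem f_apply {r : ℕ} (i : Fin r) (a b : Idx r) :
    f r i a b = if rel r i b a then 1 else 0 := by
  rcases a with a | a <;> rcases b with b | b <;>
    simp [f, rel, fVec_apply, fSpin_apply] <;> congr

theorem e_eq_transpose {r : ℕ} (i : Fin r) : e r i = (f r i)ᵀ := by
  simp [e, f, Matrix.fromBlocks_transpose, eVec, eSpin]

theorem wtVec_eq {r : ℕ} (hr : 3 ≤ r) (i : Fin r) (a : JD r) :
    wtVec r i a = if (i : ℤ) + 1 < r then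
      (if (a : ℤ) = i + 1 ∨ (a : ℤ) = -((i : ℤ) + 2) then 1
       else if (a : ℤ) = i + 2 ∨ (a : ℤ) = -((i : ℤ) + 1) then -1 else 0)
      else (if (a : ℤ) = r ∨ (a : ℤ) = (r : ℤ) - 1 then 1
       else if (a : ℤ) = -(r : ℤ) ∨ (a : ℤ) = -((r : ℤ) - 1) then -1 else 0) := by
  have hi := i.2
  obtain ⟨h0, h1, h2⟩ := a.bounds
  unfold wtVec wtPos
  generalize (a : ℤ) = z at *
  generalize (i : ℕ) = n at *
  rcases lt_or_gt_of_ne h0 with h | h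
  · rw [Int.sign_eq_neg_one_of_neg h]
    obtain ⟨k, rfl⟩ : ∃ k : ℕ, z = -(k : ℤ) := ⟨z.natAbs, by omega⟩
    simp only [Int.natAbs_neg, Int.natAbs_natCast]
    split_ifs <;> omega
  · rw [Int.sign_eq_one_of_pos h]
    obtain ⟨k, rfl⟩ : ∃ k : ℕ, z = (k : ℤ) := ⟨z.natAbs, by omega⟩
    simp only [Int.natAbs_natCast]
    split_ifs <;> omega

/-- The `x`-th coordinate of `-α_{i+1}` in the orthonormal basis of the weight space, with `x`
counted from `0`. -/
def rootCoord (r i x : ℕ) : ℤ :=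
  if i + 1 < r then (if x = i then -1 else if x = i + 1 then 1 else 0)
  else (if x = i ∨ x + 1 = i then -1 else 0)

/-- The pairing `⟨h_{j+1}, -α_{i+1}⟩`. -/
def negCartan (r j i : ℕ) : ℤ :=
  if j + 1 < r then rootCoord r i j - rootCoord r i (j + 1)
  else rootCoord r i (j - 1) + rootCoord r i j

theorem vecRel_wt {r : ℕ} (hr : 3 ≤ r) (i j : Fin r) {a b : JD r} (h : vecRel r i a b) :
    wtVec r j b = wtVec r j a + negCartan r j i := by
  have hi := i.2
  have hj := j.2
  rw [wtVec_eq hr, wtVec_eq hr]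
  unfold vecRel at h
  unfold negCartan rootCoord
  generalize (a : ℤ) = a at *
  generalize (b : ℤ) = b at *
  generalize (i : ℕ) = i at *
  generalize (j : ℕ) = j at *
  by_cases hi' : (i : ℤ) + 1 < r
  · have hi2 : i + 1 < r := by omega
    simp only [hi', hi2, if_true] at h ⊢
    by_cases hj' : (j : ℤ) + 1 < r
    · have hj2 : j + 1 < r := by omega
      simp only [hj', hj2, if_true] at h ⊢
      split_ifs <;> omega
    · have hj2 : ¬ j + 1 < r := by omega
      simp only [hj', hj2, if_false] at h ⊢
      split_ifs <;> omega
  · have hi2 : ¬ i + 1 < r := by omega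
    simp only [hi', hi2, if_false] at h ⊢
    by_cases hj' : (j : ℤ) + 1 < r
    · have hj2 : j + 1 < r := by omega
      simp only [hj', hj2, if_true] at h ⊢
      split_ifs <;> omega
    · have hj2 : ¬ j + 1 < r := by omega
      simp only [hj', hj2, if_false] at h ⊢
      split_ifs <;> omega

theorem spinRel_signVal {r : ℕ} (i : Fin r) {a b : Signs r} (h : spinRel r i a b) (x : Fin r) :
    signVal (b x) = signVal (a x) + 2 * rootCoord r i x := by
  have h := h x
  unfold spinSupp spinPat at h
  unfold signVal rootCoord
  by_cases hi : (i : ℕ) + 1 < r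
  · simp only [hi, if_true] at h ⊢
    by_cases h1 : (x : ℕ) = i
    · simp [h1] at h ⊢
      simp [h]
    · by_cases h2 : (x : ℕ) = i + 1
      · simp [h2] at h ⊢
        simp [h]
      · simp [h1, h2] at h ⊢
        simp [h]
  · simp only [hi, if_false] at h ⊢
    by_cases h1 : (x : ℕ) = i ∨ (x : ℕ) + 1 = i
    · simp [h1] at h ⊢
      simp [h]
    · simp only [h1, if_false, not_false_eq_true, true_implies, false_implies, true_and] at h ⊢
      simp [h]

theorem spinRel_wt {r : ℕ} (i j : Fin r) {a b : Signs r} (h : spinRel r i a b) :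
    wtSpin r j b = wtSpin r j a + negCartan r j i := by
  have hj := j.2
  unfold wtSpin negCartan
  split_ifs with h1
  · rw [spinRel_signVal i h, spinRel_signVal i h]
    dsimp only
    omega
  · rw [spinRel_signVal i h, spinRel_signVal i h]
    dsimp only
    omega

theorem rel_wt {r : ℕ} (hr : 3 ≤ r) (i j : Fin r) {a b : Idx r} (h : rel r i a b) :
    wt r j b = wt r j a + negCartan r j i := by
  rcases a with a | a <;> rcases b with b | b <;> simp only [rel] at h
  · exact vecRel_wt hr i j h
  · exact spinRel_wt i j h

theorem wt_of_rel {r : ℕ} (hr : 3 ≤ r) (i : Fin r) {a b : Idx r} (h : rel r i a b) :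
    wt r i a = 1 ∧ wt r i b = -1 := by
  have hi := i.2
  rcases a with a | a <;> rcases b with b | b <;> simp only [rel] at h
  · simp only [wt, Sum.elim_inl]
    rw [wtVec_eq hr, wtVec_eq hr]
    unfold vecRel at h
    split_ifs at * <;> omega
  · simp only [wt, Sum.elim_inr]
    unfold wtSpin
    unfold spinRel spinSupp spinPat at h
    split_ifs at * with h1
    · have h2 := (h i).1 (Or.inl rfl)
      have h3 := (h ⟨i + 1, h1⟩).1 (Or.inr rfl)
      simp [h2, h3, signVal]
    · have h2 := (h i).1 (Or.inl rfl)
      have h3 := (h ⟨i - 1, by omega⟩).1 (Or.inr (by simp only; omega))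
      simp [h2, h3, signVal]

/-- Both representations are minuscule: the only weights of `h_i` are `1`, `0` and `-1`, and a vector
of weight `1` or `-1` is moved by `f_i` or `e_i`. -/
theorem wt_cases {r : ℕ} (hr : 3 ≤ r) (i : Fin r) (a : Idx r) :
    (∃ b, rel r i a b) ∨ (∃ b, rel r i b a) ∨ wt r i a = 0 := by
  classical
  have hi := i.2
  rcases a with a | a
  · by_cases h0 : wt r i (.inl a) = 0
    · exact Or.inr (Or.inr h0)
    simp only [wt, Sum.elim_inl] at h0
    rw [wtVec_eq hr] at h0
    have hL : ∀ z : ℤ, z ≠ 0 → -(r : ℤ) ≤ z → z ≤ r → vecRel r i a z →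
        ∃ b, rel r i (.inl a) b := fun z h1 h2 h3 h => by
      obtain ⟨b, rfl⟩ := exists_JD h1 h2 h3
      exact ⟨.inl b, h⟩
    have hR : ∀ z : ℤ, z ≠ 0 → -(r : ℤ) ≤ z → z ≤ r → vecRel r i z a →
        ∃ b, rel r i b (.inl a) := fun z h1 h2 h3 h => by
      obtain ⟨b, rfl⟩ := exists_JD h1 h2 h3
      exact ⟨.inl b, h⟩
    unfold vecRel at hL hR
    generalize (a : ℤ) = z at *
    by_cases h1 : (i : ℤ) + 1 < r
    · simp only [h1, if_true] at hL hR h0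
      split_ifs at h0 with h2 h3
      · rcases h2 with h2 | h2
        · exact Or.inl (hL (i + 2) (by omega) (by omega) (by omega) (by omega))
        · exact Or.inl (hL (-(i + 1)) (by omega) (by omega) (by omega) (by omega))
      · rcases h3 with h2 | h2
        · exact Or.inr (Or.inl (hR (i + 1) (by omega) (by omega) (by omega) (by omega)))
        · exact Or.inr (Or.inl (hR (-(i + 2)) (by omega) (by omega) (by omega) (by omega)))
      · omega
    · simp only [h1, if_false] at hL hR h0
      split_ifs at h0 with h2 h3
      · rcases h2 with h2 | h2
        · exact Or.inl (hL (-(r - 1)) (by omega) (by omega) (by omega) (by omega))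
        · exact Or.inl (hL (-r) (by omega) (by omega) (by omega) (by omega))
      · rcases h3 with h2 | h2
        · exact Or.inr (Or.inl (hR (r - 1) (by omega) (by omega) (by omega) (by omega)))
        · exact Or.inr (Or.inl (hR r (by omega) (by omega) (by omega) (by omega)))
      · omega
  · by_cases hL : ∀ j, spinSupp r i j → a j = spinPat r i j
    · refine Or.inl ⟨.inr fun j => if spinSupp r i j then !spinPat r i j else a j, fun j => ?_⟩
      by_cases hj : spinSupp r i j <;> simp [hj]
      exact hL j hj
    by_cases hR : ∀ j, spinSupp r i j → a j = !spinPat r i j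
    · refine Or.inr (Or.inl ⟨.inr fun j => if spinSupp r i j then spinPat r i j else a j,
        fun j => ?_⟩)
      by_cases hj : spinSupp r i j <;> simp [hj]
      exact hR j hj
    refine Or.inr (Or.inr ?_)
    simp only [wt, Sum.elim_inr, wtSpin]
    unfold spinSupp spinPat at hL hR
    split_ifs at * with h1
    · have hL' : ¬ (a i = true ∧ a ⟨i + 1, h1⟩ = false) := fun h => hL fun j hj => by
        rcases hj with hj | hj
        · obtain rfl : j = i := Fin.ext hj
          simp [h]
        · obtain rfl : j = ⟨i + 1, h1⟩ := Fin.ext hj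
          simp [h]
      have hR' : ¬ (a i = false ∧ a ⟨i + 1, h1⟩ = true) := fun h => hR fun j hj => by
        rcases hj with hj | hj
        · obtain rfl : j = i := Fin.ext hj
          simp [h]
        · obtain rfl : j = ⟨i + 1, h1⟩ := Fin.ext hj
          simp [h]
      generalize a i = u at *
      generalize a ⟨i + 1, h1⟩ = v at *
      revert hL' hR'
      cases u <;> cases v <;> simp [signVal]
    · have hk : ((i : ℕ) - 1) < r := by omega
      have hL' : ¬ (a i = true ∧ a ⟨i - 1, hk⟩ = true) := fun h => hL fun j hj => by
        rcases hj with hj | hj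
        · obtain rfl : j = i := Fin.ext hj
          simp [h]
        · obtain rfl : j = ⟨i - 1, hk⟩ := Fin.ext (by simp only; omega)
          simp [h]
      have hR' : ¬ (a i = false ∧ a ⟨i - 1, hk⟩ = false) := fun h => hR fun j hj => by
        rcases hj with hj | hj
        · obtain rfl : j = i := Fin.ext hj
          simp [h]
        · obtain rfl : j = ⟨i - 1, hk⟩ := Fin.ext (by simp only; omega)
          simp [h]
      generalize a i = u at *
      generalize a ⟨i - 1, hk⟩ = v at *
      revert hL' hR'
      cases u <;> cases v <;> simp [signVal]

theorem rel_unique {r : ℕ} (i : Fin r) {a b c : Idx r} (h : rel r i a b) (h' : rel r i a c) :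
    b = c := by
  rcases a with a | a <;> rcases b with b | b <;> rcases c with c | c <;> simp only [rel] at h h'
  · unfold vecRel at h h'
    congr 1
    apply Subtype.ext
    split_ifs at h h' <;> omega
  · congr 1
    funext j
    have h1 := h j
    have h2 := h' j
    by_cases hj : spinSupp r i j
    · rw [(h1.1 hj).2, (h2.1 hj).2]
    · rw [h1.2 hj, h2.2 hj]

theorem rel_injective {r : ℕ} (i : Fin r) {a b c : Idx r} (h : rel r i b a) (h' : rel r i c a) :
    b = c := by
  rcases a with a | a <;> rcases b with b | b <;> rcases c with c | c <;> simp only [rel] at h h'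
  · unfold vecRel at h h'
    congr 1
    apply Subtype.ext
    split_ifs at h h' <;> omega
  · congr 1
    funext j
    have h1 := h j
    have h2 := h' j
    by_cases hj : spinSupp r i j
    · rw [(h1.1 hj).1, (h2.1 hj).1]
    · rw [← h1.2 hj, ← h2.2 hj]

theorem vecRel_comm {r : ℕ} (hr : 3 ≤ r) {i j : Fin r} (hij : i ≠ j) (a b : JD r) :
    (∃ c : JD r, vecRel r i a c ∧ vecRel r j b c) ↔
      ∃ c : JD r, vecRel r j c a ∧ vecRel r i c b := by
  have hi := i.2
  have hj := j.2
  have hij' : (i : ℕ) ≠ j := fun h => hij (Fin.ext h)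
  constructor
  · rintro ⟨c, h1, h2⟩
    obtain ⟨k, hk⟩ := exists_JD (r := r) (z := r - 1) (by omega) (by omega) (by omega)
    refine ⟨k, ?_⟩
    unfold vecRel at *
    split_ifs at * <;> omega
  · rintro ⟨c, h1, h2⟩
    obtain ⟨k, hk⟩ := exists_JD (r := r) (z := -(r - 1)) (by omega) (by omega) (by omega)
    refine ⟨k, ?_⟩
    unfold vecRel at *
    split_ifs at * <;> omega

/-- Two different simple roots either change disjoint sets of signs or require opposite signs at a
common position. -/
theorem spinSupp_disjoint {r : ℕ} {i j : Fin r} (hij : i ≠ j) :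
    (∀ x, ¬ (spinSupp r i x ∧ spinSupp r j x)) ∨
      ∃ x, spinSupp r i x ∧ spinSupp r j x ∧ spinPat r i x ≠ spinPat r j x := by
  by_contra! h
  obtain ⟨⟨x, h1, h2⟩, h3⟩ := h
  have hi := i.2
  have hj := j.2
  have hx := x.2
  have hij' : (i : ℕ) ≠ j := fun h => hij (Fin.ext h)
  have h4 := h3 i
  have h5 := h3 j
  have h6 := h3 x h1 h2
  unfold spinSupp spinPat at *
  split_ifs at * <;> simp at * <;> omega

theorem spinRel_comm {r : ℕ} {i j : Fin r} (hij : i ≠ j) (a b : Signs r) :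
    (∃ c, spinRel r i a c ∧ spinRel r j b c) ↔
      ∃ c, spinRel r j c a ∧ spinRel r i c b := by
  classical
  rcases spinSupp_disjoint hij with hd | ⟨x, hx1, hx2, hx3⟩
  · constructor
    · rintro ⟨c, h1, h2⟩
      refine ⟨fun x => if spinSupp r j x then b x else a x, fun x => ?_, fun x => ?_⟩ <;>
      · have := hd x
        have h1 := h1 x
        have h2 := h2 x
        by_cases hi : spinSupp r i x <;> by_cases hj : spinSupp r j x <;> simp_all
    · rintro ⟨c, h1, h2⟩
      refine ⟨fun x => if spinSupp r i x then b x else a x, fun x => ?_, fun x => ?_⟩ <;>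
      · have := hd x
        have h1 := h1 x
        have h2 := h2 x
        by_cases hi : spinSupp r i x <;> by_cases hj : spinSupp r j x <;> simp_all
  · constructor
    · rintro ⟨c, h1, h2⟩
      have e1 := ((h1 x).1 hx1).2
      have e2 := ((h2 x).1 hx2).2
      rw [e1] at e2
      exact absurd (Bool.not_inj e2) hx3
    · rintro ⟨c, h1, h2⟩
      have e1 := ((h1 x).1 hx2).1
      have e2 := ((h2 x).1 hx1).1
      rw [e1] at e2
      exact absurd e2.symm hx3

/-- The combinatorial form of `[e_i, f_j] = 0` for `i ≠ j`. -/
theorem rel_comm {r : ℕ} (hr : 3 ≤ r) {i j : Fin r} (hij : i ≠ j) (a b : Idx r) :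
    (∃ c, rel r i a c ∧ rel r j b c) ↔ ∃ c, rel r j c a ∧ rel r i c b := by
  rcases a with a | a <;> rcases b with b | b <;> simp only [rel, Sum.exists, and_false, false_and,
    exists_const, or_false]
  · exact vecRel_comm hr hij a b
  · simpa using spinRel_comm hij a b

/-! ### Relations between the generators -/

theorem exp_of_mul_self_eq_zero {n : Type*} [Fintype n] [DecidableEq n] (A : Matrix n n ℂ)
    (h : A * A = 0) : NormedSpace.exp A = 1 + A := by
  have h2 : ∀ k, 2 ≤ k → A ^ k = 0 := fun k hk => by
    obtain ⟨j, rfl⟩ := Nat.exists_eq_add_of_le hk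
    rw [pow_add, pow_two, h, zero_mul]
  rw [NormedSpace.exp_eq_tsum ℂ]
  dsimp only
  rw [tsum_eq_sum (s := Finset.range 2)]
  · simp [Finset.sum_range_succ]
  · intro k hk
    rw [h2 k (by simpa [Nat.succ_le_iff] using hk), smul_zero]

open Classical in
theorem sum_ite_and_unique {α : Type*} [Fintype α] (P Q : α → Prop)
    (h : ∀ a b, P a → P b → a = b) :
    ∑ c, (if P c then (1 : ℂ) else 0) * (if Q c then 1 else 0) =
      if ∃ c, P c ∧ Q c then 1 else 0 := by
  split_ifs with hc
  · obtain ⟨c, h1, h2⟩ := hc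
    rw [Finset.sum_eq_single c]
    · simp [h1, h2]
    · intro b _ hb
      rw [if_neg (fun h3 => hb (h _ _ h3 h1)), zero_mul]
    · simp
  · refine Finset.sum_eq_zero fun c _ => ?_
    by_cases h1 : P c
    · rw [if_neg (fun h2 => hc ⟨c, h1, h2⟩), mul_zero]
    · rw [if_neg h1, zero_mul]

open Classical in
theorem e_apply {r : ℕ} (i : Fin r) (a b : Idx r) :
    e r i a b = if rel r i a b then 1 else 0 := by
  rw [e_eq_transpose, Matrix.transpose_apply, f_apply]

open Classical in
theorem e_mul_f_apply {r : ℕ} (i j : Fin r) (a b : Idx r) :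
    (e r i * f r j) a b = if ∃ c, rel r i a c ∧ rel r j b c then 1 else 0 := by
  simp only [Matrix.mul_apply, e_apply, f_apply]
  exact sum_ite_and_unique _ _ fun c d h h' => rel_unique i h h'

open Classical in
theorem f_mul_e_apply {r : ℕ} (i j : Fin r) (a b : Idx r) :
    (f r j * e r i) a b = if ∃ c, rel r j c a ∧ rel r i c b then 1 else 0 := by
  simp only [Matrix.mul_apply, e_apply, f_apply]
  exact sum_ite_and_unique _ _ fun c d h h' => rel_injective j h h'

open Classical in
theorem e_mul_f_comm {r : ℕ} (hr : 3 ≤ r) {i j : Fin r} (hij : i ≠ j) :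
    e r i * f r j = f r j * e r i := by
  ext a b
  rw [e_mul_f_apply, f_mul_e_apply]
  exact if_congr (rel_comm hr hij a b) rfl rfl

theorem f_mul_f {r : ℕ} (hr : 3 ≤ r) (i : Fin r) : f r i * f r i = 0 := by
  ext a b
  rw [Matrix.mul_apply]
  refine Finset.sum_eq_zero fun c _ => ?_
  rw [f_apply, f_apply]
  by_cases h : rel r i c a
  · rw [if_neg (c := rel r i b c) (fun h' => ?_), mul_zero]
    have h1 := (wt_of_rel hr i h).1
    have h2 := (wt_of_rel hr i h').2
    omega
  · rw [if_neg h, zero_mul]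

theorem e_mul_e {r : ℕ} (hr : 3 ≤ r) (i : Fin r) : e r i * e r i = 0 := by
  rw [e_eq_transpose, ← Matrix.transpose_mul, f_mul_f hr, Matrix.transpose_zero]

open Classical in
theorem e_mul_f_eq_diagonal {r : ℕ} (hr : 3 ≤ r) (i : Fin r) :
    e r i * f r i = Matrix.diagonal fun a => if wt r i a = 1 then 1 else 0 := by
  ext a b
  rw [e_mul_f_apply, Matrix.diagonal_apply]
  by_cases hab : a = b
  · subst hab
    simp only [if_true, and_self]
    refine if_congr ⟨fun ⟨c, h⟩ => (wt_of_rel hr i h).1, fun h => ?_⟩ rfl rfl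
    rcases wt_cases hr i a with h1 | ⟨c, h1⟩ | h1
    · exact h1
    · have := (wt_of_rel hr i h1).2
      omega
    · omega
  · rw [if_neg hab, if_neg]
    rintro ⟨c, h1, h2⟩
    exact hab (rel_injective i h1 h2)

open Classical in
theorem f_mul_e_eq_diagonal {r : ℕ} (hr : 3 ≤ r) (i : Fin r) :
    f r i * e r i = Matrix.diagonal fun a => if wt r i a = -1 then 1 else 0 := by
  ext a b
  rw [f_mul_e_apply, Matrix.diagonal_apply]
  by_cases hab : a = b
  · subst hab
    simp only [if_true, and_self]
    refine if_congr ⟨fun ⟨c, h⟩ => (wt_of_rel hr i h).2, fun h => ?_⟩ rfl rfl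
    rcases wt_cases hr i a with ⟨c, h1⟩ | h1 | h1
    · have := (wt_of_rel hr i h1).1
      omega
    · exact h1
    · omega
  · rw [if_neg hab, if_neg]
    rintro ⟨c, h1, h2⟩
    exact hab (rel_unique i h1 h2)

theorem e_mul_f_mul_e {r : ℕ} (hr : 3 ≤ r) (i : Fin r) : e r i * f r i * e r i = e r i := by
  ext a b
  rw [e_mul_f_eq_diagonal hr, Matrix.diagonal_mul, e_apply]
  by_cases h : rel r i a b
  · simp [h, (wt_of_rel hr i h).1]
  · simp [h]

theorem f_mul_e_mul_f {r : ℕ} (hr : 3 ≤ r) (i : Fin r) : f r i * e r i * f r i = f r i := by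
  have := congrArg Matrix.transpose (e_mul_f_mul_e hr i)
  simpa [e_eq_transpose, Matrix.transpose_mul, mul_assoc] using this

/-- `t^{h_i}` as a polynomial in `e_i` and `f_i`, because `h_i` has the eigenvalues `1`, `0`, `-1`. -/
theorem torusUnit_val {r : ℕ} (hr : 3 ≤ r) (i : Fin r) (t : ℂˣ) :
    ((torusUnit r i t : (Mat r)ˣ) : Mat r) =
      1 + ((t : ℂ) - 1) • (e r i * f r i) + ((t : ℂ)⁻¹ - 1) • (f r i * e r i) := by
  rw [e_mul_f_eq_diagonal hr, f_mul_e_eq_diagonal hr]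
  change Matrix.diagonal _ = _
  ext a b
  simp only [Matrix.add_apply, Matrix.smul_apply, Matrix.diagonal_apply, Matrix.one_apply]
  by_cases hab : a = b
  · subst hab
    simp only [if_true, smul_eq_mul]
    rcases wt_cases hr i a with ⟨c, h1⟩ | ⟨c, h1⟩ | h1
    · have := (wt_of_rel hr i h1).1
      simp [this]
    · have := (wt_of_rel hr i h1).2
      simp [this]
    · simp [h1]
  · simp [hab]

theorem x_val {r : ℕ} (hr : 3 ≤ r) (i : Fin r) (t : ℂ) :
    ((x i t : (Mat r)ˣ) : Mat r) = 1 + t • e r i :=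
  exp_of_mul_self_eq_zero _ (by simp [e_mul_e hr])

theorem y_val {r : ℕ} (hr : 3 ≤ r) (i : Fin r) (t : ℂ) :
    ((y i t : (Mat r)ˣ) : Mat r) = 1 + t • f r i :=
  exp_of_mul_self_eq_zero _ (by simp [f_mul_f hr])

theorem coroot_val {r : ℕ} (hr : 3 ≤ r) (i : Fin r) (t : ℂˣ) :
    ((coroot i t : (Mat r)ˣ) : Mat r) =
      1 + ((t : ℂ) - 1) • (e r i * f r i) + ((t : ℂ)⁻¹ - 1) • (f r i * e r i) :=
  torusUnit_val hr i t

theorem G_ext {r : ℕ} {g h : G r} (H : ((g : (Mat r)ˣ) : Mat r) = ((h : (Mat r)ˣ) : Mat r)) :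
    g = h := Subtype.ext (Units.ext H)

theorem x_mul_y_comm {r : ℕ} (hr : 3 ≤ r) {i j : Fin r} (hij : i ≠ j) (s a : ℂ) :
    x i s * y j a = y j a * x i s := by
  apply G_ext
  simp only [Subgroup.coe_mul, Units.val_mul, x_val hr, y_val hr]
  simp only [mul_add, add_mul, mul_one, one_mul, smul_mul_assoc, mul_smul_comm,
    e_mul_f_comm hr hij, smul_add, smul_comm s a (f r j * e r i)]
  abel

/-- The Gauss decomposition in the subgroup `SL₂` attached to a node. -/
theorem x_mul_y_self {r : ℕ} (hr : 3 ≤ r) (i : Fin r) (s a : ℂ) (t : ℂˣ)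
    (ht : (t : ℂ) = 1 + s * a) :
    x i s * y i a = y i (a / t) * coroot i t * x i (s / t) := by
  apply G_ext
  have h0 := t.ne_zero
  have ee := e_mul_e hr i
  have ff := f_mul_f hr i
  have efe := e_mul_f_mul_e hr i
  have fef := f_mul_e_mul_f hr i
  have h1 : f r i * (e r i * f r i) = f r i := by rw [← mul_assoc, fef]
  have h2 : f r i * (f r i * e r i) = 0 := by rw [← mul_assoc, ff, zero_mul]
  have h3 : f r i * e r i * e r i = 0 := by rw [mul_assoc, ee, mul_zero]
  simp only [Subgroup.coe_mul, Units.val_mul, x_val hr, y_val hr, coroot_val hr]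
  have hs : ∀ A : Mat r, (t : ℂ) • A = A + (s * a) • A := fun A => by rw [ht, add_smul, one_smul]
  simp only [mul_add, add_mul, mul_one, one_mul, smul_mul_assoc, mul_smul_comm, smul_add,
    efe, h1, h2, h3, smul_zero, add_zero, smul_smul]
  ext p q
  simp only [Matrix.add_apply, Matrix.smul_apply, smul_eq_mul]
  generalize (1 : Mat r) p q = I
  generalize e r i p q = E
  generalize f r i p q = F
  generalize (e r i * f r i) p q = EF
  generalize (f r i * e r i) p q = FE
  have h4 : (s * a) = t - 1 := by rw [ht]; ring
  have h5 : (t : ℂ) * (t : ℂ)⁻¹ = 1 := mul_inv_cancel₀ h0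
  field_simp
  linear_combination (EF * t ^ 2 - t * FE) * h4

theorem coroot_mul_y {r : ℕ} (hr : 3 ≤ r) (i j : Fin r) (t : ℂˣ) (a : ℂ) :
    coroot j t * y i a = y i ((t ^ negCartan r j i : ℂˣ) * a) * coroot j t := by
  apply G_ext
  simp only [Subgroup.coe_mul, Units.val_mul, y_val hr]
  change Matrix.diagonal _ * _ = _ * Matrix.diagonal _
  ext p q
  rw [Matrix.diagonal_mul, Matrix.mul_diagonal]
  simp only [Matrix.add_apply, Matrix.smul_apply, smul_eq_mul, f_apply, Matrix.one_apply]
  by_cases h : rel r i q p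
  · rw [rel_wt hr i j h, zpow_add]
    by_cases hpq : p = q
    · subst hpq
      have := wt_of_rel hr i h
      omega
    · simp [hpq, h]
      ring
  · by_cases hpq : p = q
    · subst hpq
      simp [h]
    · simp [h, hpq]

/-! ### Density of the open cell -/

theorem coroot_list_val {r : ℕ} (t : Fin r → ℂˣ) (l : List (Fin r)) :
    (((l.map fun i => coroot i (t i)).prod : (Mat r)ˣ) : Mat r) =
      Matrix.diagonal fun a => (((l.map fun i => t i ^ wt r i a).prod : ℂˣ) : ℂ) := by
  induction l with
  | nil => simp
  | cons i l ih =>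
    simp only [List.map_cons, List.prod_cons, Subgroup.coe_mul, Units.val_mul, ih]
    change Matrix.diagonal _ * _ = _
    rw [Matrix.diagonal_mul_diagonal]

theorem torusElt_val {r : ℕ} (t : Fin r → ℂˣ) :
    ((torusElt t : (Mat r)ˣ) : Mat r) =
      Matrix.diagonal fun a => ((∏ i, t i ^ wt r i a : ℂˣ) : ℂ) := by
  rw [torusElt, List.ofFn_eq_map, coroot_list_val]
  simp only [← List.ofFn_eq_map, List.prod_ofFn]

theorem torusElt_one {r : ℕ} : torusElt (1 : Fin r → ℂˣ) = 1 := by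
  apply G_ext
  rw [torusElt_val]
  simp

theorem coroot_mul_torusElt {r : ℕ} (i : Fin r) (t : ℂˣ) (u : Fin r → ℂˣ) :
    coroot i t * torusElt u = torusElt (Pi.mulSingle i t * u) := by
  apply G_ext
  rw [torusElt_val, Subgroup.coe_mul, Units.val_mul, torusElt_val]
  change Matrix.diagonal _ * _ = _
  rw [Matrix.diagonal_mul_diagonal]
  congr 1
  funext a
  simp only [Pi.mul_apply, mul_zpow, Finset.prod_mul_distrib, Units.val_mul]
  congr 2
  rw [Finset.prod_eq_single i]
  · simp
  · intro j _ hj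
    simp [Pi.mulSingle_eq_of_ne hj]
  · simp

theorem y_inv {r : ℕ} (hr : 3 ≤ r) (i : Fin r) (t : ℂ) : (y i t)⁻¹ = y i (-t) := by
  rw [inv_eq_iff_mul_eq_one]
  apply G_ext
  simp [y_val hr, mul_add, add_mul, f_mul_f hr]

theorem x_inv {r : ℕ} (hr : 3 ≤ r) (i : Fin r) (t : ℂ) : (x i t)⁻¹ = x i (-t) := by
  rw [inv_eq_iff_mul_eq_one]
  apply G_ext
  simp [x_val hr, mul_add, add_mul, e_mul_e hr]

theorem coroot_inv {r : ℕ} (i : Fin r) (t : ℂˣ) : (coroot i t)⁻¹ = coroot i t⁻¹ := by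
  rw [inv_eq_iff_mul_eq_one]
  apply G_ext
  rw [Subgroup.coe_mul, Units.val_mul]
  change Matrix.diagonal _ * Matrix.diagonal _ = 1
  rw [Matrix.diagonal_mul_diagonal, ← Matrix.diagonal_one]
  congr 1
  funext a
  rw [← Units.val_mul, inv_zpow, mul_inv_cancel, Units.val_one]

theorem y_mem_Nminus {r : ℕ} (i : Fin r) (t : ℂ) : y i t ∈ Nminus r :=
  Subgroup.subset_closure ⟨i, t, rfl⟩

theorem x_mem_N {r : ℕ} (i : Fin r) (t : ℂ) : x i t ∈ N r :=
  Subgroup.subset_closure ⟨i, t, rfl⟩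

theorem Nminus_induction {r : ℕ} (hr : 3 ≤ r) {p : G r → Prop} (one : p 1)
    (mul : ∀ i t g, p g → p (y i t * g)) {g : G r} (hg : g ∈ Nminus r) : p g := by
  induction hg using Subgroup.closure_induction_left with
  | one => exact one
  | mul_left a ha b _ ih =>
    obtain ⟨i, t, rfl⟩ := ha
    exact mul i t b ih
  | inv_mul_cancel a ha b _ ih =>
    obtain ⟨i, t, rfl⟩ := ha
    rw [y_inv hr]
    exact mul i _ b ih

theorem N_induction {r : ℕ} (hr : 3 ≤ r) {p : G r → Prop} (one : p 1)
    (mul : ∀ i t g, p g → p (x i t * g)) {g : G r} (hg : g ∈ N r) : p g := by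
  induction hg using Subgroup.closure_induction_left with
  | one => exact one
  | mul_left a ha b _ ih =>
    obtain ⟨i, t, rfl⟩ := ha
    exact mul i t b ih
  | inv_mul_cancel a ha b _ ih =>
    obtain ⟨i, t, rfl⟩ := ha
    rw [x_inv hr]
    exact mul i _ b ih

theorem coroot_mul_mem_Nminus {r : ℕ} (hr : 3 ≤ r) (j : Fin r) (t : ℂˣ) {g : G r}
    (hg : g ∈ Nminus r) : ∃ g' ∈ Nminus r, coroot j t * g = g' * coroot j t := by
  refine Nminus_induction hr (p := fun g => ∃ g' ∈ Nminus r, coroot j t * g = g' * coroot j t)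
    ⟨1, one_mem _, by simp⟩ (fun i a g ih => ?_) hg
  · obtain ⟨g', h1, h2⟩ := ih
    refine ⟨y i ((t ^ negCartan r j i : ℂˣ) * a) * g',
      mul_mem (y_mem_Nminus i _) h1, ?_⟩
    rw [← mul_assoc, coroot_mul_y hr, mul_assoc, h2, mul_assoc]

theorem torusElt_mul {r : ℕ} (t u : Fin r → ℂˣ) :
    torusElt t * torusElt u = torusElt (t * u) := by
  apply G_ext
  rw [Subgroup.coe_mul, Units.val_mul, torusElt_val, torusElt_val, torusElt_val,
    Matrix.diagonal_mul_diagonal]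
  simp only [Pi.mul_apply, mul_zpow, Finset.prod_mul_distrib, Units.val_mul]

theorem x_mul_torusElt {r : ℕ} (hr : 3 ≤ r) (i : Fin r) (s : ℂ) (t : Fin r → ℂˣ) :
    x i s * torusElt t =
      torusElt t * x i (((∏ j, t j ^ negCartan r j i : ℂˣ) : ℂ) * s) := by
  apply G_ext
  rw [Subgroup.coe_mul, Subgroup.coe_mul, Units.val_mul, Units.val_mul, torusElt_val,
    x_val hr, x_val hr]
  ext p q
  rw [Matrix.diagonal_mul, Matrix.mul_diagonal]
  simp only [Matrix.add_apply, Matrix.smul_apply, smul_eq_mul, e_apply, Matrix.one_apply]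
  by_cases h : rel r i p q
  · by_cases hpq : p = q
    · subst hpq
      have := wt_of_rel hr i h
      omega
    · simp only [rel_wt hr i _ h, zpow_add, Finset.prod_mul_distrib, hpq, h, if_false, if_true,
        Units.val_mul]
      ring
  · by_cases hpq : p = q
    · subst hpq
      simp [h]
    · simp [h, hpq]

/-- The open cell `G_0 = N_- H N`. -/
def bigCell (r : ℕ) : Set (G r) :=
  {g | ∃ n₁ ∈ Nminus r, ∃ t, ∃ n₂ ∈ N r, g = n₁ * torusElt t * n₂}

/-- For `g` in `N_-` the product `x_i(s) g` lies in `N_- H x_i(ℂ)` for all but finitely many `s`: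
`x_i(s)` moves past the factors `y_j(a)` of `g` with `j ≠ i`, and past `y_i(a)` it becomes
`x_i(s / (1 + s a))` unless `1 + s a = 0`. -/
theorem finite_not_mem_cell {r : ℕ} (hr : 3 ≤ r) (i : Fin r) {g : G r} (hg : g ∈ Nminus r) :
    {s : ℂ | ¬ ∃ n ∈ Nminus r, ∃ u s', x i s * g = n * torusElt u * x i s'}.Finite := by
  refine Nminus_induction hr (p := fun g => {s : ℂ | ¬ ∃ n ∈ Nminus r, ∃ u s',
    x i s * g = n * torusElt u * x i s'}.Finite) ?_ (fun j a g ih => ?_) hg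
  · refine Set.finite_empty.subset fun s hs => hs ⟨1, one_mem _, 1, s, ?_⟩
    rw [torusElt_one]
    simp
  · by_cases hij : i = j
    · subst hij
      -- `s ↦ s / (1 - s a)` is the inverse of `s ↦ s / (1 + s a)`
      refine ((ih.image fun s => s / (1 - s * a)).union (Set.finite_singleton (-1 / a))).subset
        fun s hs => ?_
      by_cases h0 : 1 + s * a = 0
      · right
        have ha : a ≠ 0 := fun h => by simp [h] at h0
        rw [Set.mem_singleton_iff, eq_div_iff ha]
        linear_combination h0
      · left
        refine ⟨s / (1 + s * a), fun ⟨n, hn, u, s', hx⟩ => hs ?_, ?_⟩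
        · obtain ⟨n', hn', hn2⟩ := coroot_mul_mem_Nminus hr i (Units.mk0 _ h0) hn
          refine ⟨_, mul_mem (y_mem_Nminus i (a / (1 + s * a))) hn',
            Pi.mulSingle i (Units.mk0 _ h0) * u, s', ?_⟩
          rw [← mul_assoc, x_mul_y_self hr i s a (Units.mk0 _ h0) rfl, Units.val_mk0, mul_assoc, hx,
            ← coroot_mul_torusElt]
          simp only [mul_assoc]
          rw [← mul_assoc (coroot i _) n, hn2]
          simp only [mul_assoc]
        · have : 1 - s / (1 + s * a) * a = 1 / (1 + s * a) := by field_simp; ring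
          simp only [this]
          field_simp
    · refine ih.subset fun s hs ⟨n, hn, u, s', hx⟩ => hs
        ⟨_, mul_mem (y_mem_Nminus j a) hn, u, s', ?_⟩
      rw [← mul_assoc, x_mul_y_comm hr hij, mul_assoc, hx]
      simp only [mul_assoc]

theorem IsRegular.mul_left {r : ℕ} {Δ : G r → ℂ} (h : IsRegular Δ) (g₀ : G r) :
    IsRegular fun g => Δ (g₀ * g) := by
  obtain ⟨P, hP⟩ := h
  refine ⟨MvPolynomial.bind₁ (fun p => ∑ c, MvPolynomial.C (((g₀ : (Mat r)ˣ) : Mat r) p.1 c) *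
    MvPolynomial.X (c, p.2)) P, fun g => ?_⟩
  change Δ (g₀ * g) = _
  rw [hP, ← MvPolynomial.coe_aeval_eq_eval, ← MvPolynomial.coe_aeval_eq_eval]
  simp only [RingHom.coe_coe, MvPolynomial.aeval_bind₁]
  congr 2
  funext p
  simp [Matrix.mul_apply]

/-- A regular function that vanishes on the open cell vanishes on `G`. Left translation by a
generator preserves these functions: the cell is stable under `y_i(s)` and `t^{h_i}`, and
`Δ (x_i(s) g)` is a polynomial in `s` that vanishes for all but finitely many `s`. -/
theorem eq_zero_of_bigCell {r : ℕ} (hr : 3 ≤ r) (g : (Mat r)ˣ) (hg : g ∈ G r) :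
    ∀ Δ : G r → ℂ, IsRegular Δ → (∀ g ∈ bigCell r, Δ g = 0) → Δ ⟨g, hg⟩ = 0 := by
  have hx : ∀ (i : Fin r) (s : ℂ) (Δ : G r → ℂ), IsRegular Δ → (∀ g ∈ bigCell r, Δ g = 0) →
      ∀ g ∈ bigCell r, Δ (x i s * g) = 0 := by
    rintro i s Δ ⟨P, hP⟩ h0 g ⟨n₁, hn₁, t, n₂, hn₂, rfl⟩
    set g := n₁ * torusElt t * n₂ with hg
    let Q : Polynomial ℂ := MvPolynomial.aeval (fun p : Idx r × Idx r =>
      Polynomial.C (((g : (Mat r)ˣ) : Mat r) p.1 p.2) +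
        Polynomial.X * Polynomial.C ((e r i * ((g : (Mat r)ˣ) : Mat r)) p.1 p.2)) P
    have hQ : ∀ s, Q.eval s = Δ (x i s * g) := fun s => by
      rw [hP, ← MvPolynomial.coe_aeval_eq_eval, ← Polynomial.coe_aeval_eq_eval]
      change (Polynomial.aeval s) (MvPolynomial.aeval _ P) = _
      rw [← AlgHom.comp_apply, MvPolynomial.comp_aeval]
      simp only [RingHom.coe_coe]
      congr 2
      funext p
      simp [x_val hr, add_mul, mul_comm s]
    suffices Q = 0 by rw [← hQ, this, Polynomial.eval_zero]
    apply Polynomial.eq_zero_of_infinite_isRoot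
    refine (finite_not_mem_cell hr i hn₁).infinite_compl.mono fun s hs => ?_
    simp only [Set.mem_compl_iff, Set.mem_ofPred_eq, not_not] at hs
    obtain ⟨n, hn, u, s', h1⟩ := hs
    change Q.eval s = 0
    rw [hQ]
    refine h0 _ ⟨n, hn, u * t, x i (((∏ j, t j ^ negCartan r j i : ℂˣ) : ℂ) * s') * n₂,
      mul_mem (x_mem_N i _) hn₂, ?_⟩
    rw [hg, ← torusElt_mul, ← mul_assoc, ← mul_assoc, h1, mul_assoc n _ (x i s'),
      mul_assoc n, mul_assoc _ (x i s'), x_mul_torusElt hr]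
    simp only [mul_assoc]
  have hy : ∀ (i : Fin r) (s : ℂ), ∀ g ∈ bigCell r, y i s * g ∈ bigCell r := by
    rintro i s _ ⟨n₁, hn₁, t, n₂, hn₂, rfl⟩
    exact ⟨_, mul_mem (y_mem_Nminus i s) hn₁, t, n₂, hn₂, by simp only [mul_assoc]⟩
  have hc : ∀ (i : Fin r) (s : ℂˣ), ∀ g ∈ bigCell r, coroot i s * g ∈ bigCell r := by
    rintro i s _ ⟨n₁, hn₁, t, n₂, hn₂, rfl⟩
    obtain ⟨n', hn', h⟩ := coroot_mul_mem_Nminus hr i s hn₁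
    refine ⟨n', hn', Pi.mulSingle i s * t, n₂, hn₂, ?_⟩
    rw [← coroot_mul_torusElt, ← mul_assoc, ← mul_assoc, h]
    simp only [mul_assoc]
  -- left translation by a generator or its inverse preserves the regular functions
  -- that vanish on the open cell
  have key : ∀ (a : (Mat r)ˣ) (ha : a ∈ G r),
      (∀ Δ : G r → ℂ, IsRegular Δ → (∀ g ∈ bigCell r, Δ g = 0) →
        ∀ g ∈ bigCell r, Δ (⟨a, ha⟩ * g) = 0) →
      ∀ (b : (Mat r)ˣ) (hb : b ∈ G r), (∀ Δ : G r → ℂ, IsRegular Δ →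
        (∀ g ∈ bigCell r, Δ g = 0) → Δ ⟨b, hb⟩ = 0) →
      ∀ Δ : G r → ℂ, IsRegular Δ → (∀ g ∈ bigCell r, Δ g = 0) → Δ ⟨a * b, mul_mem ha hb⟩ = 0 :=
    fun a ha h b hb ih Δ hΔ h0 => ih _ (hΔ.mul_left ⟨a, ha⟩) (h Δ hΔ h0)
  induction hg using Subgroup.closure_induction_left with
  | one =>
    exact fun Δ _ h0 => h0 _ ⟨1, one_mem _, 1, 1, one_mem _, by rw [torusElt_one]; simp; rfl⟩
  | mul_left a ha b hb ih =>
    refine key a (Subgroup.subset_closure ha) (fun Δ hΔ h0 => ?_) b hb ih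
    rcases ha with (⟨i, s, rfl⟩ | ⟨i, s, rfl⟩) | ⟨i, s, rfl⟩
    · exact hx i s Δ hΔ h0
    · exact fun g hg => h0 _ (hy i s g hg)
    · exact fun g hg => h0 _ (hc i s g hg)
  | inv_mul_cancel a ha b hb ih =>
    refine key a⁻¹ (inv_mem (Subgroup.subset_closure ha)) (fun Δ hΔ h0 => ?_) b hb ih
    rcases ha with (⟨i, s, rfl⟩ | ⟨i, s, rfl⟩) | ⟨i, s, rfl⟩
    · intro g hg
      have := hx i (-s) Δ hΔ h0 g hg
      rwa [← x_inv hr] at this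
    · intro g hg
      have := h0 _ (hy i (-s) g hg)
      rwa [← y_inv hr] at this
    · intro g hg
      have := h0 _ (hc i s⁻¹ g hg)
      rwa [← coroot_inv] at this

/-- Two regular functions on `G` that agree on a translate of the open cell are equal. -/
theorem regular_ext {r : ℕ} (hr : 3 ≤ r) (u : G r) {Δ₁ Δ₂ : G r → ℂ} (h₁ : IsRegular Δ₁)
    (h₂ : IsRegular Δ₂) (h : ∀ g ∈ bigCell r, Δ₁ (u * g) = Δ₂ (u * g)) : Δ₁ = Δ₂ := by
  funext g
  obtain ⟨P, hP⟩ := h₁.mul_left u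
  obtain ⟨Q, hQ⟩ := h₂.mul_left u
  have := eq_zero_of_bigCell hr _ (u⁻¹ * g).2 (fun g => Δ₁ (u * g) - Δ₂ (u * g))
    ⟨P - Q, fun g => by simp only [hP, hQ, map_sub]⟩ fun g hg => by
      simp only [h g hg, sub_self]
  change Δ₁ (u * (u⁻¹ * g)) - Δ₂ (u * (u⁻¹ * g)) = 0 at this
  rwa [mul_inv_cancel_left, sub_eq_zero] at this

/-! ### Generalized minors in the vector representation -/

/-- The vector representation is a direct summand, so the blocks off the diagonal vanish; one of them
is enough to make `vec` multiplicative. -/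
theorem G_upper_right {r : ℕ} (hr : 3 ≤ r) (g : (Mat r)ˣ) (hg : g ∈ G r) (a : JD r) (b : Signs r) :
    (g : Mat r) (.inl a) (.inr b) = 0 := by
  have hx : ∀ (i : Fin r) (s : ℂ) (a : JD r) (b : Signs r),
      ((x i s : (Mat r)ˣ) : Mat r) (.inl a) (.inr b) = 0 := fun i s a b => by
    simp [x_val hr, e_apply, rel]
  have hy : ∀ (i : Fin r) (s : ℂ) (a : JD r) (b : Signs r),
      ((y i s : (Mat r)ˣ) : Mat r) (.inl a) (.inr b) = 0 := fun i s a b => by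
    simp [y_val hr, f_apply, rel]
  have hc : ∀ (i : Fin r) (s : ℂˣ) (a : JD r) (b : Signs r),
      ((coroot i s : (Mat r)ˣ) : Mat r) (.inl a) (.inr b) = 0 := fun i s a b => by
    change Matrix.diagonal _ _ _ = 0
    simp
  have key : ∀ A : Mat r, (∀ (a : JD r) (b : Signs r), A (.inl a) (.inr b) = 0) →
      ∀ B : Mat r, (∀ (a : JD r) (b : Signs r), B (.inl a) (.inr b) = 0) →
      ∀ (a : JD r) (b : Signs r), (A * B) (.inl a) (.inr b) = 0 := fun A hA B hB a b => by
    simp [Matrix.mul_apply, Fintype.sum_sum_type, hA, hB]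
  revert a b
  induction hg using Subgroup.closure_induction_left with
  | one => intro a b; simp
  | mul_left u hu v hv ih =>
    refine key u ?_ v ih
    rcases hu with (⟨i, s, rfl⟩ | ⟨i, s, rfl⟩) | ⟨i, s, rfl⟩
    · exact hx i s
    · exact hy i s
    · exact hc i s
  | inv_mul_cancel u hu v hv ih =>
    refine key _ ?_ v ih
    rcases hu with (⟨i, s, rfl⟩ | ⟨i, s, rfl⟩) | ⟨i, s, rfl⟩
    · have := hx i (-s)
      rwa [← x_inv hr] at this
    · have := hy i (-s)
      rwa [← y_inv hr] at this
    · have := hc i s⁻¹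
      rwa [← coroot_inv] at this

/-- The block of `g` on the vector representation. -/
def vec {r : ℕ} (g : G r) : Matrix (JD r) (JD r) ℂ := ((g : (Mat r)ˣ) : Mat r).toBlocks₁₁

theorem vec_one {r : ℕ} : vec (1 : G r) = 1 := by
  ext a b
  simp [vec, Matrix.toBlocks₁₁, Matrix.one_apply]

theorem vec_mul {r : ℕ} (hr : 3 ≤ r) (g h : G r) : vec (g * h) = vec g * vec h := by
  ext a b
  simp [vec, Matrix.toBlocks₁₁, Matrix.mul_apply, Fintype.sum_sum_type, G_upper_right hr _ g.2]

open Classical in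
theorem vec_x {r : ℕ} (hr : 3 ≤ r) (i : Fin r) (t : ℂ) (a b : JD r) :
    vec (x i t) a b = (if a = b then 1 else 0) + t * if vecRel r i a b then 1 else 0 := by
  simp only [vec, Matrix.toBlocks₁₁, x_val hr, Matrix.of_apply, Matrix.add_apply,
    Matrix.smul_apply, e_apply, rel, Matrix.one_apply, Sum.inl.injEq, smul_eq_mul]
  congr

open Classical in
theorem vec_y {r : ℕ} (hr : 3 ≤ r) (i : Fin r) (t : ℂ) (a b : JD r) :
    vec (y i t) a b = (if a = b then 1 else 0) + t * if vecRel r i b a then 1 else 0 := by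
  simp only [vec, Matrix.toBlocks₁₁, y_val hr, Matrix.of_apply, Matrix.add_apply,
    Matrix.smul_apply, f_apply, rel, Matrix.one_apply, Sum.inl.injEq, smul_eq_mul]
  congr

theorem vec_coroot {r : ℕ} (i : Fin r) (t : ℂˣ) :
    vec (coroot i t) = Matrix.diagonal fun a => (t : ℂ) ^ wtVec r i a := by
  ext a b
  change (Matrix.diagonal (fun a => ((t ^ wt r i a : ℂˣ) : ℂ)) : Mat r) (.inl a) (.inl b) = _
  simp [Matrix.diagonal_apply, wt]

/-- The letter `i + 1` of `J_D`. -/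
def letter {r d : ℕ} (hd : d ≤ r) (i : Fin d) : JD r :=
  ⟨(i : ℤ) + 1, by
    have := i.2
    simp only [Finset.mem_erase, Finset.mem_Icc]
    omega⟩

theorem letter_injective {r d : ℕ} (hd : d ≤ r) : Function.Injective (letter hd) := fun i j h => by
  have : (i : ℤ) + 1 = (j : ℤ) + 1 := congrArg Subtype.val h
  exact Fin.ext (by omega)

theorem eq_letter {r d : ℕ} (hd : d ≤ r) {c : JD r} (h1 : 0 < (c : ℤ)) (h2 : (c : ℤ) ≤ d) :
    c ∈ Set.range (letter hd) :=
  ⟨⟨(c : ℤ).toNat - 1, by omega⟩, Subtype.ext (by simp only [letter]; omega)⟩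

theorem submatrix_mul_of_support {α β R : Type*} [Fintype α] [Fintype β] [CommRing R]
    {L : β → α} (hL : Function.Injective L)
    (A B : Matrix α α R) (h : ∀ i j c, c ∉ Set.range L → A (L i) c * B c (L j) = 0) :
    (A * B).submatrix L L = A.submatrix L L * B.submatrix L L := by
  ext i j
  simp only [Matrix.submatrix_apply, Matrix.mul_apply]
  exact (Finset.sum_of_injOn L hL.injOn (by simp) (fun c _ hc => h i j c (by simpa using hc))
    (fun _ _ => rfl)).symm

/-- The leading principal minor of size `d` in the vector representation, that is, the coefficient of
`v_1 ∧ ⋯ ∧ v_d` in `g (v_1 ∧ ⋯ ∧ v_d)`. -/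
def leadingMinor {r d : ℕ} (hd : d ≤ r) (g : G r) : ℂ :=
  ((vec g).submatrix (letter hd) (letter hd)).det

theorem leadingMinor_isRegular {r d : ℕ} (hd : d ≤ r) : IsRegular (leadingMinor (r := r) hd) := by
  refine ⟨(Matrix.of fun i j => MvPolynomial.X (.inl (letter hd i), .inl (letter hd j))).det,
    fun g => ?_⟩
  rw [RingHom.map_det]
  unfold leadingMinor
  congr 1
  ext i j
  simp [vec, Matrix.toBlocks₁₁]

theorem vec_y_apply_letter {r d : ℕ} (hr : 3 ≤ r) (hd : d + 2 ≤ r) (i : Fin r) (t : ℂ) (a : Fin d)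
    (c : JD r) (hc : (c : ℤ) < 0 ∨ (a : ℤ) + 1 < c) :
    vec (y i t) (letter (by omega) a) c = 0 := by
  have ha := a.2
  rw [vec_y hr, if_neg, if_neg, mul_zero, add_zero]
  · unfold vecRel
    simp only [letter]
    split_ifs <;> omega
  · rintro rfl
    simp only [letter] at hc
    omega

theorem vec_x_apply_letter {r d : ℕ} (hr : 3 ≤ r) (hd : d + 2 ≤ r) (i : Fin r) (t : ℂ) (a : Fin d)
    (c : JD r) (hc : (c : ℤ) < 0 ∨ (a : ℤ) + 1 < c) :
    vec (x i t) c (letter (by omega) a) = 0 := by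
  have ha := a.2
  rw [vec_x hr, if_neg, if_neg, mul_zero, add_zero]
  · unfold vecRel
    simp only [letter]
    split_ifs <;> omega
  · rintro rfl
    simp only [letter] at hc
    omega

theorem not_mem_range_letter {r d : ℕ} (hd : d ≤ r) {c : JD r}
    (hc : c ∉ Set.range (letter hd)) : (c : ℤ) < 0 ∨ (d : ℤ) < c := by
  by_contra! h
  have := c.bounds.1
  exact hc (eq_letter hd (by omega) (by omega))

theorem leadingMinor_y_mul {r d : ℕ} (hr : 3 ≤ r) (hd : d + 2 ≤ r) (i : Fin r) (t : ℂ) (g : G r) :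
    leadingMinor (d := d) (by omega) (y i t * g) = leadingMinor (d := d) (by omega) g := by
  unfold leadingMinor
  rw [vec_mul hr, submatrix_mul_of_support (letter_injective _), Matrix.det_mul,
    Matrix.det_of_isLowerTriangular, Finset.prod_eq_one, one_mul]
  · intro a _
    rw [Matrix.submatrix_apply, vec_y hr, if_pos rfl, if_neg, mul_zero, add_zero]
    unfold vecRel
    split_ifs <;> omega
  · intro a b hab
    refine vec_y_apply_letter hr hd i t a _ (Or.inr ?_)
    have : (a : ℕ) < b := by simpa using hab
    simp only [letter]
    omega
  · intro a b c hc
    rw [vec_y_apply_letter hr hd, zero_mul]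
    have := a.2
    rcases not_mem_range_letter _ hc with h | h <;> omega

theorem leadingMinor_N {r d : ℕ} (hr : 3 ≤ r) (hd : d + 2 ≤ r) {g : G r} (hg : g ∈ N r) :
    leadingMinor (d := d) (by omega) g = 1 := by
  refine (N_induction hr (p := fun g => leadingMinor (d := d) (by omega) g = 1 ∧
    ∀ (a : Fin d) c, c ∉ Set.range (letter (r := r) (d := d) (by omega)) →
      vec g c (letter (by omega) a) = 0) ⟨?_, ?_⟩
    (fun i t g ih => ⟨?_, ?_⟩) hg).1
  · rw [leadingMinor, vec_one, Matrix.submatrix_one _ (letter_injective _), Matrix.det_one]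
  · intro a c hc
    rw [vec_one, Matrix.one_apply_ne]
    rintro rfl
    exact hc ⟨a, rfl⟩
  · refine Eq.trans ?_ ih.1
    unfold leadingMinor
    rw [vec_mul hr, submatrix_mul_of_support (letter_injective _), Matrix.det_mul,
      Matrix.det_of_isUpperTriangular, Finset.prod_eq_one, one_mul]
    · intro a _
      rw [Matrix.submatrix_apply, vec_x hr, if_pos rfl, if_neg, mul_zero, add_zero]
      unfold vecRel
      split_ifs <;> omega
    · intro a b hab
      refine vec_x_apply_letter hr hd i t b _ (Or.inr ?_)
      have : (b : ℕ) < a := by simpa using hab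
      simp only [letter]
      omega
    · intro a b c hc
      rw [ih.2 b c hc, mul_zero]
  · intro a c hc
    rw [vec_mul hr, Matrix.mul_apply]
    refine Finset.sum_eq_zero fun c' _ => ?_
    by_cases hc' : c' ∈ Set.range (letter (r := r) (d := d) (by omega))
    · obtain ⟨b, rfl⟩ := hc'
      rw [vec_x_apply_letter hr hd, zero_mul]
      have := b.2
      rcases not_mem_range_letter _ hc with h | h <;> omega
    · rw [ih.2 a c' hc', mul_zero]

/-- The weight of `v_1 ∧ ⋯ ∧ v_d` is the fundamental weight `Λ_d`. -/
theorem sum_wtVec_letter {r d : ℕ} (hr : 3 ≤ r) (hd : d + 2 ≤ r) (i : Fin r) :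
    ∑ a : Fin d, wtVec r i (letter (by omega) a) = if (i : ℕ) + 1 = d then 1 else 0 := by
  have hi := i.2
  have h : ∀ a : Fin d, wtVec r i (letter (by omega) a) =
      (if (a : ℕ) = i then 1 else 0) - (if (a : ℕ) = i + 1 then 1 else 0) := fun a => by
    have ha := a.2
    rw [wtVec_eq hr]
    simp only [letter]
    split_ifs <;> omega
  simp only [h]
  rw [Fin.sum_univ_eq_sum_range (fun a => (if a = (i : ℕ) then (1 : ℤ) else 0) -
    (if a = i + 1 then 1 else 0)), Finset.sum_sub_distrib, Finset.sum_ite_eq',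
    Finset.sum_ite_eq']
  simp only [Finset.mem_range]
  split_ifs <;> omega

theorem zpow_sum {K ι : Type*} [Field K] {t : K} (ht : t ≠ 0) (s : Finset ι) (n : ι → ℤ) :
    t ^ (∑ a ∈ s, n a) = ∏ a ∈ s, t ^ n a := by
  classical
  induction s using Finset.induction_on with
  | empty => simp
  | insert a s ha ih => rw [Finset.sum_insert ha, Finset.prod_insert ha, zpow_add₀ ht, ih]

theorem leadingMinor_coroot_mul {r d : ℕ} (hr : 3 ≤ r) (hd : d + 2 ≤ r) (i : Fin r) (t : ℂˣ)
    (g : G r) : leadingMinor (d := d) (by omega) (coroot i t * g) =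
      (if (i : ℕ) + 1 = d then (t : ℂ) else 1) * leadingMinor (d := d) (by omega) g := by
  unfold leadingMinor
  rw [vec_mul hr, submatrix_mul_of_support (letter_injective _), Matrix.det_mul, vec_coroot,
    Matrix.submatrix_diagonal _ _ (letter_injective _), Matrix.det_diagonal]
  · congr 1
    simp only [Function.comp_apply]
    rw [← zpow_sum t.ne_zero, sum_wtVec_letter hr hd]
    split_ifs <;> simp
  · intro a b c hc
    rw [vec_coroot, Matrix.diagonal_apply_ne, zero_mul]
    rintro rfl
    exact hc ⟨a, rfl⟩

theorem leadingMinor_torusElt_mul {r d : ℕ} (hr : 3 ≤ r) (hd : d + 2 ≤ r) (j : Fin r)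
    (hj : (j : ℕ) + 1 = d) (t : Fin r → ℂˣ)
    (g : G r) : leadingMinor (d := d) (by omega) (torusElt t * g) =
      t j * leadingMinor (d := d) (by omega) g := by
  have : ∀ l : List (Fin r), l.Nodup →
      leadingMinor (d := d) (by omega) ((l.map fun i => coroot i (t i)).prod * g) =
      (if j ∈ l then (t j : ℂ) else 1) * leadingMinor (d := d) (by omega) g := by
    intro l hl
    induction l with
    | nil => simp
    | cons i l ih =>
      rw [List.nodup_cons] at hl
      rw [List.map_cons, List.prod_cons, mul_assoc, leadingMinor_coroot_mul hr hd, ih hl.2]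
      by_cases hij : i = j
      · subst hij
        simp [hj, hl.1]
      · have : ¬ (i : ℕ) + 1 = d := fun h => hij (Fin.ext (by omega))
        simp [this, Ne.symm hij]
  rw [torusElt, List.ofFn_eq_map, this _ (List.nodup_finRange r), if_pos (List.mem_finRange j)]

/-- For `d ≤ r - 2` the generalized minor is a minor of size `d` of the vector representation. -/
theorem isGeneralizedMinor_leadingMinor {r d : ℕ} (hr : 3 ≤ r) (hd : d + 2 ≤ r) (j : Fin r)
    (hj : (j : ℕ) + 1 = d) (w : List (Fin r)) :
    IsGeneralizedMinor w j fun g => leadingMinor (d := d) (by omega) ((ubar w)⁻¹ * g) := by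
  refine ⟨(leadingMinor_isRegular _).mul_left _, fun g n₁ hn₁ t n₂ hn₂ h => ?_⟩
  dsimp only
  rw [h, mul_assoc]
  refine (Nminus_induction hr (p := fun n => ∀ g, leadingMinor (d := d) (by omega) (n * g) =
    leadingMinor (d := d) (by omega) g) (fun g => by rw [one_mul]) (fun i s n ih g => ?_)
    hn₁ _).trans ?_
  · rw [mul_assoc, leadingMinor_y_mul hr hd, ih]
  · rw [leadingMinor_torusElt_mul hr hd j hj, leadingMinor_N hr hd hn₂, mul_one]

theorem isGeneralizedMinor_unique {r : ℕ} (hr : 3 ≤ r) (j : Fin r) (w : List (Fin r))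
    {Δ₁ Δ₂ : G r → ℂ} (h₁ : IsGeneralizedMinor w j Δ₁) (h₂ : IsGeneralizedMinor w j Δ₂) :
    Δ₁ = Δ₂ := by
  refine regular_ext hr (ubar w) h₁.1 h₂.1 ?_
  rintro g ⟨n₁, hn₁, t, n₂, hn₂, rfl⟩
  rw [h₁.2 _ n₁ hn₁ t n₂ hn₂ (inv_mul_cancel_left _ _), h₂.2 _ n₁ hn₁ t n₂ hn₂
    (inv_mul_cancel_left _ _)]

/-! ### The action on row vectors -/

/-- The right action of `x_{-n}(t)` on row vectors, where `1 ≤ n ≤ r`. A row vector is given by a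
function on the integers, of which only the values on `J_D` matter. -/
def rowStep (r n : ℕ) (t : ℂ) (z : ℤ → ℂ) (a : ℤ) : ℂ :=
  if n < r then
    if a = n ∨ a = -((n : ℤ) + 1) then t⁻¹ * z a + z (a + 1)
    else if a = (n : ℤ) + 1 ∨ a = -(n : ℤ) then t * z a else z a
  else
    if a = r then t⁻¹ * z a + z (-((r : ℤ) - 1))
    else if a = (r : ℤ) - 1 then t⁻¹ * z a + z (-(r : ℤ))
    else if a = -(r : ℤ) ∨ a = -((r : ℤ) - 1) then t * z a else z a

/-- The right action of the representative of `s_n` on row vectors, where `1 ≤ n ≤ r`. -/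
def sbarStep (r n : ℕ) (z : ℤ → ℂ) (a : ℤ) : ℂ :=
  if n < r then
    if a = n ∨ a = -((n : ℤ) + 1) then z (a + 1)
    else if a = (n : ℤ) + 1 ∨ a = -(n : ℤ) then -z (a - 1) else z a
  else
    if a = r then z (-((r : ℤ) - 1))
    else if a = (r : ℤ) - 1 then z (-(r : ℤ))
    else if a = -(r : ℤ) then -z ((r : ℤ) - 1)
    else if a = -((r : ℤ) - 1) then -z r else z a

/-- The value at `f_i v_a` of the linear form with coordinates `z`. -/
def lowered (r n : ℕ) (z : ℤ → ℂ) (a : ℤ) : ℂ :=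
  if n < r then (if a = n ∨ a = -((n : ℤ) + 1) then z (a + 1) else 0)
  else (if a = r then z (-((r : ℤ) - 1)) else if a = (r : ℤ) - 1 then z (-(r : ℤ)) else 0)

/-- The value at `e_i v_a` of the linear form with coordinates `z`. -/
def raised (r n : ℕ) (z : ℤ → ℂ) (a : ℤ) : ℂ :=
  if n < r then (if a = (n : ℤ) + 1 ∨ a = -(n : ℤ) then z (a - 1) else 0)
  else (if a = -((r : ℤ) - 1) then z r else if a = -(r : ℤ) then z ((r : ℤ) - 1) else 0)

open Classical in
theorem sum_ite_eq_of_iff {r : ℕ} (z : ℤ → ℂ) {P : JD r → Prop} {v : ℤ} (h1 : v ≠ 0)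
    (h2 : -(r : ℤ) ≤ v) (h3 : v ≤ r) (h : ∀ c : JD r, P c ↔ (c : ℤ) = v) :
    ∑ c : JD r, z c * (if P c then 1 else 0) = z v := by
  obtain ⟨b, rfl⟩ := exists_JD h1 h2 h3
  simp only [h]
  rw [Finset.sum_eq_single b]
  · simp
  · intro c _ hc
    rw [if_neg (fun h => hc (Subtype.ext h)), mul_zero]
  · simp

open Classical in
theorem sum_ite_eq_zero {r : ℕ} (z : ℤ → ℂ) {P : JD r → Prop} (h : ∀ c : JD r, ¬ P c) :
    ∑ c : JD r, z c * (if P c then 1 else 0) = 0 :=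
  Finset.sum_eq_zero fun c _ => by rw [if_neg (h c), mul_zero]

open Classical in
theorem sum_vecRel_right {r : ℕ} (hr : 3 ≤ r) (i : Fin r) (z : ℤ → ℂ) (a : JD r) :
    ∑ c : JD r, z c * (if vecRel r i a c then 1 else 0) = lowered r (i + 1) z a := by
  have hi := i.2
  have ha := a.bounds
  unfold lowered
  push_cast
  by_cases h : (i : ℕ) + 1 < r
  · have h' : (i : ℤ) + 1 < r := by omega
    simp only [h, if_true]
    split_ifs with h1
    · refine sum_ite_eq_of_iff z ?_ ?_ ?_ fun c => ?_ <;>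
        first | omega | (rw [vecRel, if_pos h']; omega)
    · refine sum_ite_eq_zero z fun c => ?_
      rw [vecRel, if_pos h']
      omega
  · have h' : ¬ (i : ℤ) + 1 < r := by omega
    simp only [h, if_false]
    split_ifs with h1 h2
    · refine sum_ite_eq_of_iff z ?_ ?_ ?_ fun c => ?_ <;>
        first | omega | (rw [vecRel, if_neg h']; omega)
    · refine sum_ite_eq_of_iff z ?_ ?_ ?_ fun c => ?_ <;>
        first | omega | (rw [vecRel, if_neg h']; omega)
    · refine sum_ite_eq_zero z fun c => ?_
      rw [vecRel, if_neg h']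
      omega

open Classical in
theorem sum_vecRel_left {r : ℕ} (hr : 3 ≤ r) (i : Fin r) (z : ℤ → ℂ) (a : JD r) :
    ∑ c : JD r, z c * (if vecRel r i c a then 1 else 0) = raised r (i + 1) z a := by
  have hi := i.2
  have ha := a.bounds
  unfold raised
  push_cast
  by_cases h : (i : ℕ) + 1 < r
  · have h' : (i : ℤ) + 1 < r := by omega
    simp only [h, if_true]
    split_ifs with h1
    · refine sum_ite_eq_of_iff z ?_ ?_ ?_ fun c => ?_ <;>
        first | omega | (rw [vecRel, if_pos h']; omega)
    · refine sum_ite_eq_zero z fun c => ?_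
      rw [vecRel, if_pos h']
      omega
  · have h' : ¬ (i : ℤ) + 1 < r := by omega
    simp only [h, if_false]
    split_ifs with h1 h2
    · refine sum_ite_eq_of_iff z ?_ ?_ ?_ fun c => ?_ <;>
        first | omega | (rw [vecRel, if_neg h']; omega)
    · refine sum_ite_eq_of_iff z ?_ ?_ ?_ fun c => ?_ <;>
        first | omega | (rw [vecRel, if_neg h']; omega)
    · refine sum_ite_eq_zero z fun c => ?_
      rw [vecRel, if_neg h']
      omega

/-- The row vector with coordinates `z a`, `a` in `J_D`. -/
def row (r : ℕ) (z : ℤ → ℂ) : JD r → ℂ := fun a => z a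

theorem row_vecMul_y {r : ℕ} (hr : 3 ≤ r) (i : Fin r) (t : ℂ) (z : ℤ → ℂ) :
    row r z ᵥ* vec (y i t) = row r fun a => z a + t * lowered r (i + 1) z a := by
  classical
  funext a
  simp only [row, Matrix.vecMul, dotProduct, vec_y hr, mul_add, Finset.sum_add_distrib]
  rw [← sum_vecRel_right hr, Finset.mul_sum]
  congr 1
  · simp
  · exact Finset.sum_congr rfl fun c _ => by ring

theorem row_vecMul_x {r : ℕ} (hr : 3 ≤ r) (i : Fin r) (t : ℂ) (z : ℤ → ℂ) :
    row r z ᵥ* vec (x i t) = row r fun a => z a + t * raised r (i + 1) z a := by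
  classical
  funext a
  simp only [row, Matrix.vecMul, dotProduct, vec_x hr, mul_add, Finset.sum_add_distrib]
  rw [← sum_vecRel_left hr, Finset.mul_sum]
  congr 1
  · simp
  · exact Finset.sum_congr rfl fun c _ => by ring

theorem row_vecMul_xneg {r : ℕ} (hr : 3 ≤ r) (i : Fin r) (t : ℂˣ) (z : ℤ → ℂ) :
    row r z ᵥ* vec (xneg i t) = row r (rowStep r (i + 1) t z) := by
  rw [xneg, vec_mul hr, ← Matrix.vecMul_vecMul, row_vecMul_y hr, vec_coroot]
  funext a
  have hi := i.2
  have ha := a.bounds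
  have ht := t.ne_zero
  rw [Matrix.vecMul_diagonal, wtVec_eq hr]
  unfold row lowered rowStep
  push_cast
  by_cases h : (i : ℕ) + 1 < r
  · have h' : (i : ℤ) + 1 < r := by omega
    have e1 : (i : ℤ) + 1 + 1 = i + 2 := by ring
    simp only [h, h', if_true, e1]
    split_ifs
    · simp; field_simp
    · simp [mul_comm]
    · simp
  · have h' : ¬ (i : ℤ) + 1 < r := by omega
    simp only [h, h', if_false]
    split_ifs <;> first | (exfalso; omega) | skip
    all_goals simp
    all_goals field_simp

theorem row_vecMul_sbar {r : ℕ} (hr : 3 ≤ r) (i : Fin r) (z : ℤ → ℂ) :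
    row r z ᵥ* vec (sbar i) = row r (sbarStep r (i + 1) z) := by
  rw [sbar, vec_mul hr, vec_mul hr, ← Matrix.vecMul_vecMul, ← Matrix.vecMul_vecMul,
    row_vecMul_x hr, row_vecMul_y hr, row_vecMul_x hr]
  funext a
  have hi := i.2
  have ha := a.bounds
  unfold row lowered raised sbarStep
  push_cast
  generalize (a : ℤ) = a at *
  by_cases h : (i : ℕ) + 1 < r
  · simp only [h, if_true]
    by_cases h1 : a = (i : ℤ) + 1 ∨ a = -((i : ℤ) + 1 + 1)
    · split_ifs <;> first | (exfalso; omega) | ring_nf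
    · by_cases h2 : a = (i : ℤ) + 1 + 1 ∨ a = -((i : ℤ) + 1)
      · split_ifs <;> first | (exfalso; omega) | ring_nf
      · simp only [h1, h2, if_false]
        ring
  · simp only [h, if_false]
    have hc : a = r ∨ a = (r : ℤ) - 1 ∨ a = -(r : ℤ) ∨ a = -((r : ℤ) - 1) ∨
        (a ≠ r ∧ a ≠ (r : ℤ) - 1 ∧ a ≠ -(r : ℤ) ∧ a ≠ -((r : ℤ) - 1)) := by omega
    rcases hc with rfl | rfl | rfl | rfl | ⟨h1, h2, h3, h4⟩
    · split_ifs <;> first | (exfalso; omega) | ring_nf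
    · split_ifs <;> first | (exfalso; omega) | ring_nf
    · split_ifs <;> first | (exfalso; omega) | ring_nf
    · split_ifs <;> first | (exfalso; omega) | ring_nf
    · simp only [h1, h2, h3, h4, if_false]
      ring

theorem row_vecMul_list_prod {r : ℕ} (hr : 3 ≤ r) (l : List (G r)) (S : ℕ → ℤ → ℂ)
    (h : ∀ p (hp : p < l.length), row r (S p) ᵥ* vec l[p] = row r (S (p + 1))) :
    row r (S 0) ᵥ* vec l.prod = row r (S l.length) := by
  induction l generalizing S with
  | nil => simp [vec_one]
  | cons g l ih =>
    rw [List.prod_cons, vec_mul hr, ← Matrix.vecMul_vecMul]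
    have h0 := h 0 (by simp)
    rw [List.getElem_cons_zero] at h0
    rw [h0]
    exact ih (fun p => S (p + 1)) fun p hp => by
      have := h (p + 1) (by simpa using hp)
      rwa [List.getElem_cons_succ] at this

/-! ### The action of a cycle -/

/-- The sum of `z(j̄) / t_{j-1}` over the letters `j̄ ≥ ā`. -/
def barSum (t : ℕ → ℂ) (z : ℤ → ℂ) (a : ℕ) : ℂ :=
  ∑ j ∈ Finset.range a, z (-((j : ℤ) + 1)) / t j

section cycle
variable {r : ℕ} {t : ℕ → ℂ} {Z : ℕ → ℤ → ℂ}

theorem rowStep_cycle_pos (hZ : ∀ n < r, Z (n + 1) = rowStep r (n + 1) (t (n + 1)) (Z n))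
    (t0 : t 0 = 1) {n : ℕ} (hn : n < r) {a : ℕ} (ha : 1 ≤ a) (har : a ≤ r) :
    Z n a = if a ≤ n then t (a - 1) / t a * Z 0 a + Z 0 (a + 1)
      else if a = n + 1 then t n * Z 0 a else Z 0 a := by
  induction n generalizing a with
  | zero =>
    rw [if_neg (by omega)]
    split_ifs <;> simp [t0]
  | succ n ih =>
    rw [hZ n (by omega), rowStep, if_pos hn]
    push_cast
    rcases Nat.lt_trichotomy a (n + 1) with h | h | h
    · rw [if_neg (by omega), if_neg (by omega), ih (by omega) ha har, if_pos (by omega),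
        if_pos (by omega)]
    · subst h
      have := ih (by omega) (a := n + 2) (by omega) (by omega)
      rw [if_neg (by omega), if_neg (by omega)] at this
      rw [if_pos (by omega), ih (by omega) ha har, if_neg (by omega), if_pos rfl, if_pos le_rfl]
      push_cast at this ⊢
      rw [show (n : ℤ) + 1 + 1 = n + 2 by ring, this]
      ring
    · have := ih (by omega) ha har
      rw [if_neg (by omega), if_neg (by omega)] at this
      rw [this]
      split_ifs <;> first | (exfalso; omega) | rfl

theorem rowStep_cycle_neg (hZ : ∀ n < r, Z (n + 1) = rowStep r (n + 1) (t (n + 1)) (Z n))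
    (t0 : t 0 = 1) {n : ℕ} (hn : n < r) {a : ℕ} (ha : 1 ≤ a) (har : a ≤ r) :
    Z n (-(a : ℤ)) = if a ≤ n then t a * barSum t (Z 0) a
      else if a = n + 1 then barSum t (Z 0) a else Z 0 (-(a : ℤ)) := by
  induction n generalizing a with
  | zero =>
    rw [if_neg (by omega)]
    split_ifs with h
    · subst h
      simp [t0, barSum]
    · rfl
  | succ n ih =>
    rw [hZ n (by omega), rowStep, if_pos hn]
    push_cast
    rcases Nat.lt_trichotomy a (n + 1) with h | h | h
    · rw [if_neg (by omega), if_neg (by omega), ih (by omega) ha har, if_pos (by omega),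
        if_pos (by omega)]
    · subst h
      rw [if_neg (by omega), if_pos (by omega), ih (by omega) ha har, if_neg (by omega), if_pos rfl,
        if_pos le_rfl]
    · rw [if_neg (c := a ≤ n + 1) (by omega)]
      by_cases h' : a = n + 1 + 1
      · subst h'
        have := ih (by omega) (a := n + 1) (by omega) (by omega)
        rw [if_neg (by omega), if_pos rfl] at this
        rw [if_pos (by omega), ih (by omega) ha har, if_neg (by omega), if_neg (by omega), if_pos rfl,
          show -((n + 1 + 1 : ℕ) : ℤ) + 1 = -((n + 1 : ℕ) : ℤ) by push_cast; ring, this]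
        rw [barSum, barSum, Finset.sum_range_succ _ (n + 1)]
        push_cast
        ring
      · rw [if_neg (by omega), if_neg (by omega), ih (by omega) ha har, if_neg (by omega),
          if_neg (by omega), if_neg h']

theorem rowStep_cycle_full (hr : 3 ≤ r)
    (hZ : ∀ n < r, Z (n + 1) = rowStep r (n + 1) (t (n + 1)) (Z n)) (t0 : t 0 = 1) :
    (∀ a : ℕ, 1 ≤ a → a + 2 ≤ r → Z r a = t (a - 1) / t a * Z 0 a + Z 0 (a + 1)) ∧
    (Z r ((r : ℤ) - 1) = t (r - 2) / (t (r - 1) * t r) * Z 0 ((r : ℤ) - 1) +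
      (Z 0 r / t r + barSum t (Z 0) r)) ∧
    (Z r r = t (r - 1) * (Z 0 r / t r + barSum t (Z 0) (r - 1))) ∧
    ∀ a : ℕ, 1 ≤ a → a ≤ r →
      Z r (-(a : ℤ)) = (if a + 1 = r then t r * t (r - 1) else t a) * barSum t (Z 0) a := by
  obtain ⟨n, rfl⟩ : ∃ n, r = n + 1 := ⟨r - 1, by omega⟩
  have hp := fun a h1 h2 => rowStep_cycle_pos hZ t0 (n := n) (by omega) (a := a) h1 h2
  have hm := fun a h1 h2 => rowStep_cycle_neg hZ t0 (n := n) (by omega) (a := a) h1 h2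
  rw [hZ n (by omega)]
  unfold rowStep
  have hn : (((n + 1 : ℕ) : ℤ)) - 1 = n := by push_cast; ring
  rw [hn]
  refine ⟨fun a h1 h2 => ?_, ?_, ?_, fun a h1 h2 => ?_⟩
  · have h := hp a h1 (by omega)
    rw [if_pos (by omega)] at h
    split_ifs <;> first | (exfalso; omega) | exact h
  · have h1 := hp n (by omega) (by omega)
    have h2 := hm (n + 1) (by omega) (by omega)
    rw [if_pos le_rfl] at h1
    rw [if_neg (by omega), if_pos rfl] at h2
    split_ifs <;> first | (exfalso; omega) | skip
    rw [h1, h2, show n + 1 - 2 = n - 1 by omega, Nat.add_sub_cancel]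
    push_cast
    have : (t (n + 1))⁻¹ * (t (n - 1) / t n) = t (n - 1) / (t n * t (n + 1)) := by
      rw [div_mul_eq_div_div, div_eq_mul_inv _ (t (n + 1)), mul_comm]
    rw [← this]
    ring
  · have h1 := hp (n + 1) (by omega) (by omega)
    have h2 := hm n (by omega) (by omega)
    rw [if_neg (by omega), if_pos rfl] at h1
    rw [if_pos le_rfl] at h2
    split_ifs <;> first | (exfalso; omega) | skip
    rw [h1, h2, Nat.add_sub_cancel]
    ring
  · have h := hm a h1 h2
    rw [Nat.add_sub_cancel]
    split_ifs at h ⊢ <;> first | (exfalso; omega) | skip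
    · rw [h]
      obtain rfl : a = n := by omega
      ring
    · obtain rfl : a = n + 1 := by omega
      rw [h]
    · exact h

end cycle

/-! ### Rows of chain sums -/

open Classical in
theorem sum_ordLE_eq {r : ℕ} (g : ℤ → ℂ) (t : ℤ) (s : Finset ℤ)
    (hs : ∀ k, k ∈ s ↔ (k ≠ 0 ∧ -(r : ℤ) ≤ k ∧ k ≤ r) ∧ ordLE r t k) :
    ∑ k : JD r, (if ordLE r t k then g k else 0) = ∑ k ∈ s, g k := by
  rw [Finset.sum_coe_sort ((Finset.Icc (-(r : ℤ)) (r : ℤ)).erase 0)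
    (fun k => if ordLE r t k then g k else 0), ← Finset.sum_filter]
  congr 1
  ext k
  rw [hs]
  simp

/-- The letters `ā, …, 1̄`. -/
def barLetters (a : ℕ) : Finset ℤ := (Finset.range a).image fun j : ℕ => -((j : ℤ) + 1)

theorem mem_barLetters {a : ℕ} {k : ℤ} : k ∈ barLetters a ↔ k < 0 ∧ -(a : ℤ) ≤ k := by
  simp only [barLetters, Finset.mem_image, Finset.mem_range]
  constructor
  · rintro ⟨j, hj, rfl⟩
    omega
  · rintro ⟨h1, h2⟩
    exact ⟨(-k - 1).toNat, by omega, by omega⟩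

theorem sum_barLetters (g : ℤ → ℂ) (a : ℕ) :
    ∑ k ∈ barLetters a, g k = ∑ j ∈ Finset.range a, g (-((j : ℤ) + 1)) :=
  Finset.sum_image fun i _ j _ h => by simpa using h

section
variable {r : ℕ} (g : ℤ → ℂ)

open Classical in
theorem sum_ordLE_neg {a : ℕ} (ha : 1 ≤ a) (har : a ≤ r) :
    ∑ k : JD r, (if ordLE r (-(a : ℤ)) k then g k else 0) =
      ∑ j ∈ Finset.range a, g (-((j : ℤ) + 1)) := by
  rw [sum_ordLE_eq g _ (barLetters a), sum_barLetters]
  intro k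
  rw [mem_barLetters]
  unfold ordLE height
  split_ifs <;> omega

open Classical in
theorem sum_ordLE_r (hr : 3 ≤ r) :
    ∑ k : JD r, (if ordLE r (r : ℤ) k then g k else 0) =
      g r + ∑ j ∈ Finset.range (r - 1), g (-((j : ℤ) + 1)) := by
  rw [sum_ordLE_eq g _ (insert (r : ℤ) (barLetters (r - 1))), Finset.sum_insert, sum_barLetters]
  · rw [mem_barLetters]
    omega
  · intro k
    rw [Finset.mem_insert, mem_barLetters]
    unfold ordLE height
    split_ifs <;> omega

open Classical in
theorem sum_ordLE_sub_one (hr : 3 ≤ r) :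
    ∑ k : JD r, (if ordLE r ((r : ℤ) - 1) k then g k else 0) =
      g ((r : ℤ) - 1) + (g r + ∑ j ∈ Finset.range r, g (-((j : ℤ) + 1))) := by
  rw [sum_ordLE_eq g _ (insert ((r : ℤ) - 1) (insert (r : ℤ) (barLetters r))), Finset.sum_insert,
    Finset.sum_insert, sum_barLetters]
  · rw [mem_barLetters]
    omega
  · rw [Finset.mem_insert, mem_barLetters]
    omega
  · intro k
    rw [Finset.mem_insert, Finset.mem_insert, mem_barLetters]
    unfold ordLE height
    split_ifs <;> omega

open Classical in
theorem sum_ordLE_pos {a : ℕ} (ha : 1 ≤ a) (har : a + 2 ≤ r) :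
    ∑ k : JD r, (if ordLE r (a : ℤ) k then g k else 0) =
      g a + ∑ k : JD r, (if ordLE r ((a : ℤ) + 1) k then g k else 0) := by
  rw [sum_ordLE_eq g ((a : ℤ) + 1) (((Finset.Icc (-(r : ℤ)) r).erase 0).filter
      (ordLE r ((a : ℤ) + 1))) (fun k => by simp),
    sum_ordLE_eq g _ (insert (a : ℤ) (((Finset.Icc (-(r : ℤ)) r).erase 0).filter
      (ordLE r ((a : ℤ) + 1)))), Finset.sum_insert]
  · rw [Finset.mem_filter]
    unfold ordLE height
    split_ifs <;> omega
  · intro k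
    rw [Finset.mem_insert, Finset.mem_filter, Finset.mem_erase, Finset.mem_Icc]
    unfold ordLE height
    split_ifs <;> omega

end

/-- The numerator of the monomial `D(q, ā)` in the coordinates `c`. -/
def barWeight (r : ℕ) (c : ℕ → ℕ → ℂ) (q a : ℕ) : ℂ :=
  if a + 1 = r then c q r * c q (r - 1) else c q a

/-- The weights `F n k` are the monomials `D(l, k)` in the coordinates `c`, for the index `l` that
belongs to `n` and `k`: it is `m + n - k` if `1 ≤ k ≤ r - 1` and `m + n - r` otherwise. -/
structure IsWeight (r m : ℕ) (c : ℕ → ℕ → ℂ) (F : ℕ → ℤ → ℂ) : Prop where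
  pos : ∀ q a : ℕ, 1 ≤ a → a + 2 ≤ r → m ≤ q + a + 1 →
    F (q + a + 1 - m) a = c (q + 1) (a - 1) / c (q + 1) a
  sub_one : ∀ q, F (q + r - m) ((r : ℤ) - 1) =
    c (q + 1) (r - 2) / (c (q + 1) (r - 1) * c (q + 1) r)
  last : ∀ q, F (q + r - m) r = c q (r - 1) / c (q + 1) r
  neg : ∀ q a : ℕ, 1 ≤ a → a ≤ r →
    F (q + r - m) (-(a : ℤ)) = barWeight r c q a / c (q + 1) (a - 1)

/-- The row vector `z` obtained after `q` cycles consists of the chain sums with starting index `i`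
and upper bound `e`, up to the factor `κ` and, at the letters `r, r̄, …, 1̄`, the numerators of
`D(q, ·)`. -/
structure IsChainRow (r m : ℕ) (c : ℕ → ℕ → ℂ) (F : ℕ → ℤ → ℂ) (κ : ℂ) (e : ℤ) (i q : ℕ)
    (z : ℤ → ℂ) : Prop where
  pos : ∀ a : ℕ, 1 ≤ a → a + 1 ≤ r → z a = κ * chainSum r F e i (q + a + 1 - m) a
  last : z r = κ * c q (r - 1) * chainSum r F e i (q + r - m) r
  neg : ∀ a : ℕ, 1 ≤ a → a ≤ r →
    z (-(a : ℤ)) = κ * barWeight r c q a * chainSum r F e i (q + r - m) (-(a : ℤ))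

section
variable {r m : ℕ} {c : ℕ → ℕ → ℂ} {F : ℕ → ℤ → ℂ} {κ : ℂ} {e : ℤ} {i q : ℕ} {z : ℤ → ℂ}

/-- The effect of a cycle on the coordinates `1, …, r - 2`. At the start of the chains the condition
`he` is needed, because the empty chains at `a` and at `a + 1` must have the same sum. -/
theorem IsChainRow.upper (hF : IsWeight r m c F) (h : IsChainRow r m c F κ e i q z) (hi : 1 ≤ i)
    (he : ∀ a : ℕ, 1 ≤ a → a + 2 ≤ r → q + a + 2 = m + i → ordLE r a e ∧ ordLE r ((a : ℤ) + 1) e)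
    {a : ℕ} (ha : 1 ≤ a) (har : a + 2 ≤ r) :
    c (q + 1) (a - 1) / c (q + 1) a * z a + z (a + 1) =
      κ * chainSum r F e i (q + 1 + a + 1 - m) a := by
  have h1 := h.pos a ha (by omega)
  have h2 := h.pos (a + 1) (by omega) (by omega)
  push_cast at h2
  rw [h1, h2]
  rcases Nat.lt_trichotomy (q + a + 2) (m + i) with hc | hc | hc
  · rw [chainSum_of_lt (by omega), chainSum_of_lt (by omega), chainSum_of_lt (by omega)]
    ring
  · obtain ⟨e1, e2⟩ := he a ha har hc
    rw [chainSum_of_lt (by omega), show q + 1 + a + 1 - m = i by omega,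
      show q + (a + 1) + 1 - m = i by omega, chainSum_self, chainSum_self, if_pos e1, if_pos e2]
    ring
  · have e1 : q + 1 + a + 1 - m = q + a + 1 - m + 1 := by omega
    have e2 : q + (a + 1) + 1 - m = q + a + 1 - m + 1 := by omega
    rw [e1, e2, chainSum_succ (by omega), chainSum_succ (by omega),
      sum_ordLE_pos (fun k => F (q + a + 1 - m) k * chainSum r F e i (q + a + 1 - m) k) ha har,
      hF.pos q a ha har (by omega)]
    ring

theorem IsChainRow.barSum_eq (hF : IsWeight r m c F) (h : IsChainRow r m c F κ e i q z) {a : ℕ}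
    (har : a ≤ r) :
    barSum (c (q + 1)) z a =
      κ * ∑ j ∈ Finset.range a, F (q + r - m) (-((j : ℤ) + 1)) *
        chainSum r F e i (q + r - m) (-((j : ℤ) + 1)) := by
  rw [barSum, Finset.mul_sum]
  refine Finset.sum_congr rfl fun j hj => ?_
  rw [Finset.mem_range] at hj
  have h1 := h.neg (j + 1) (by omega) (by omega)
  have h2 := hF.neg q (j + 1) (by omega) (by omega)
  push_cast at h1 h2
  rw [h1, h2]
  ring

/-- A cycle maps rows of chain sums to rows of chain sums: it performs the summation over the next
letter of the chain. -/
theorem IsChainRow.step (hr : 3 ≤ r) (hmr : m ≤ r) (hF : IsWeight r m c F)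
    (h : IsChainRow r m c F κ e i q z) (hi : 1 ≤ i) (hiq : i ≤ q + r - m)
    (he : ∀ a : ℕ, 1 ≤ a → a + 2 ≤ r → q + a + 2 = m + i → ordLE r a e ∧ ordLE r ((a : ℤ) + 1) e)
    {Z : ℕ → ℤ → ℂ} (hZ0 : Z 0 = z) (c0 : c (q + 1) 0 = 1)
    (hZ : ∀ n < r, Z (n + 1) = rowStep r (n + 1) (c (q + 1) (n + 1)) (Z n)) :
    IsChainRow r m c F κ e i (q + 1) (Z r) := by
  obtain ⟨z1, z2, z3, z4⟩ := rowStep_cycle_full hr hZ c0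
  rw [hZ0] at z1 z2 z3 z4
  have e1 : q + 1 + r - m = q + r - m + 1 := by omega
  have hzr : z r / c (q + 1) r = κ * (F (q + r - m) r * chainSum r F e i (q + r - m) r) := by
    rw [h.last, hF.last]
    ring
  refine ⟨fun a ha har => ?_, ?_, fun a ha har => ?_⟩
  · rcases Nat.lt_or_ge (a + 1) r with hlt | hge
    · rw [z1 a ha hlt]
      exact h.upper hF hi he ha hlt
    · have har' : ((a : ℕ) : ℤ) = (r : ℤ) - 1 := by omega
      have h1 := h.pos a ha har
      rw [har'] at h1 ⊢
      rw [z2, show q + 1 + a + 1 - m = q + r - m + 1 by omega, chainSum_succ hiq,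
        sum_ordLE_sub_one (fun k => F (q + r - m) k * chainSum r F e i (q + r - m) k) hr, hzr, h1,
        h.barSum_eq hF le_rfl, hF.sub_one, show q + a + 1 - m = q + r - m by omega]
      ring
  · rw [z3, hzr, h.barSum_eq hF (by omega), e1, chainSum_succ hiq,
      sum_ordLE_r (fun k => F (q + r - m) k * chainSum r F e i (q + r - m) k) hr]
    ring
  · rw [z4 a ha har, h.barSum_eq hF har, e1, chainSum_succ hiq,
      sum_ordLE_neg (fun k => F (q + r - m) k * chainSum r F e i (q + r - m) k) ha har, barWeight]
    ring

end

/-- The linear form `ε • v_E^*`. -/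
def unitRow (ε : ℂ) (E : ℤ) (a : ℤ) : ℂ := if a = E then ε else 0

section
variable {r m : ℕ} {c : ℕ → ℕ → ℂ} {F : ℕ → ℤ → ℂ}

theorem isChainRow_unitRow_pos (hm : 1 ≤ m) (hmr : m ≤ r) (ε : ℂ) {i : ℕ} (hi : 1 ≤ i)
    (hir : m + i ≤ r) :
    IsChainRow r m c F ε ((m : ℤ) - 1 + i) i 0 (unitRow ε ((m : ℤ) - 1 + i)) := by
  refine ⟨fun a ha har => ?_, ?_, fun a ha har => ?_⟩
  · unfold unitRow
    rcases lt_trichotomy (a : ℤ) ((m : ℤ) - 1 + i) with h | h | h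
    · rw [if_neg (by omega), chainSum_of_lt (by omega), mul_zero]
    · rw [if_pos h, show 0 + a + 1 - m = i by omega, chainSum_self, if_pos (by exact Or.inl h),
        mul_one]
    · rw [if_neg (by omega), chainSum_eq_zero, mul_zero]
      unfold ordLE height
      split_ifs <;> omega
  · rw [unitRow, if_neg (by omega), chainSum_eq_zero, mul_zero]
    unfold ordLE height
    split_ifs <;> omega
  · rw [unitRow, if_neg (by omega), chainSum_eq_zero, mul_zero]
    unfold ordLE height
    split_ifs <;> omega

/-- The form `ε • v_{j̄}^*` is not itself a row of chain sums, but it becomes one after a cycle. The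
factor `(c 1 (j - 1))⁻¹` is the denominator of `D(0, j̄)`. -/
theorem isChainRow_unitRow_neg (hr : 3 ≤ r) (hmr : m ≤ r) (ε : ℂ) {j : ℕ} (hj : 1 ≤ j)
    (hjr : j + 2 ≤ r) {Z : ℕ → ℤ → ℂ} (hZ0 : Z 0 = unitRow ε (-(j : ℤ))) (c0 : c 1 0 = 1)
    (hZ : ∀ n < r, Z (n + 1) = rowStep r (n + 1) (c 1 (n + 1)) (Z n)) :
    IsChainRow r m c F (ε / c 1 (j - 1)) (-(j : ℤ)) (r - m + 1) 1 (Z r) := by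
  obtain ⟨z1, z2, z3, z4⟩ := rowStep_cycle_full hr hZ c0
  rw [hZ0] at z1 z2 z3 z4
  have hb : ∀ a, barSum (c 1) (unitRow ε (-(j : ℤ))) a = if j ≤ a then ε / c 1 (j - 1) else 0 := by
    intro a
    unfold barSum unitRow
    split_ifs with h
    · rw [Finset.sum_eq_single (j - 1)]
      · rw [if_pos (by omega)]
      · intro b _ hb
        rw [if_neg (by omega), zero_div]
      · intro hb
        rw [Finset.mem_range] at hb
        omega
    · refine Finset.sum_eq_zero fun b hb => ?_
      rw [Finset.mem_range] at hb
      rw [if_neg (by omega), zero_div]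
  have e1 : 1 + r - m = r - m + 1 := by omega
  refine ⟨fun a ha har => ?_, ?_, fun a ha har => ?_⟩
  · rcases Nat.lt_or_ge (a + 1) r with hlt | hge
    · rw [z1 a ha hlt, chainSum_of_lt (by omega), unitRow, unitRow, if_neg (by omega),
        if_neg (by omega)]
      ring
    · have har' : ((a : ℕ) : ℤ) = (r : ℤ) - 1 := by omega
      rw [har', z2, hb, show 1 + a + 1 - m = r - m + 1 by omega, chainSum_self, if_pos (by omega),
        if_pos (by unfold ordLE height; split_ifs <;> omega), unitRow, unitRow, if_neg (by omega),
        if_neg (by omega)]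
      ring
  · rw [z3, hb, e1, chainSum_self, if_pos (by omega),
      if_pos (by unfold ordLE height; split_ifs <;> omega), unitRow, if_neg (by omega)]
    ring
  · rw [z4 a ha har, hb, e1, chainSum_self, barWeight]
    have : ordLE r (-(a : ℤ)) (-(j : ℤ)) ↔ j ≤ a := by
      unfold ordLE height
      split_ifs <;> omega
    simp only [this]
    split_ifs <;> ring

end

/-! ### The rows of the Weyl group representative -/

section cycle
variable {r : ℕ} {Z : ℕ → ℤ → ℂ}

theorem sbarStep_cycle_pos (hZ : ∀ n < r, Z (n + 1) = sbarStep r (n + 1) (Z n))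
    {n : ℕ} (hn : n < r) {a : ℕ} (ha : 1 ≤ a) (har : a ≤ r) :
    Z n a = if a ≤ n then Z 0 (a + 1) else if a = n + 1 then (-1) ^ n * Z 0 1 else Z 0 a := by
  induction n generalizing a with
  | zero =>
    rw [if_neg (by omega)]
    split_ifs with h
    · subst h
      simp
    · rfl
  | succ n ih =>
    rw [hZ n (by omega), sbarStep, if_pos hn]
    push_cast
    rcases Nat.lt_trichotomy a (n + 1) with h | h | h
    · have := ih (by omega) ha har
      rw [if_pos (by omega)] at this
      rw [this]
      split_ifs <;> first | (exfalso; omega) | rfl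
    · subst h
      have := ih (by omega) (a := n + 2) (by omega) (by omega)
      rw [if_neg (by omega), if_neg (by omega)] at this
      push_cast at this ⊢
      rw [if_pos (Or.inl rfl), if_pos le_rfl, show (n : ℤ) + 1 + 1 = n + 2 by ring, this]
    · by_cases h' : a = n + 2
      · subst h'
        have := ih (by omega) (a := n + 1) (by omega) (by omega)
        rw [if_neg (by omega), if_pos rfl] at this
        push_cast at this ⊢
        rw [if_neg (by omega), if_pos (by omega), if_neg (by omega), if_pos (by omega),
          show (n : ℤ) + 2 - 1 = n + 1 by ring, this]
        ring
      · have := ih (by omega) ha har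
        rw [if_neg (by omega), if_neg (by omega)] at this
        rw [this]
        split_ifs <;> first | (exfalso; omega) | rfl

theorem sbarStep_cycle_neg (hZ : ∀ n < r, Z (n + 1) = sbarStep r (n + 1) (Z n))
    {n : ℕ} (hn : n < r) {a : ℕ} (ha : 1 ≤ a) (har : a ≤ r) :
    Z n (-(a : ℤ)) = if a ≤ n then -Z 0 (-((a : ℤ) + 1))
      else if a = n + 1 then Z 0 (-1) else Z 0 (-(a : ℤ)) := by
  induction n generalizing a with
  | zero =>
    rw [if_neg (by omega)]
    split_ifs with h
    · subst h
      rfl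
    · rfl
  | succ n ih =>
    rw [hZ n (by omega), sbarStep, if_pos hn]
    push_cast
    rcases Nat.lt_trichotomy a (n + 1) with h | h | h
    · have := ih (by omega) ha har
      rw [if_pos (by omega)] at this
      rw [this]
      split_ifs <;> first | (exfalso; omega) | rfl
    · subst h
      have := ih (by omega) (a := n + 2) (by omega) (by omega)
      rw [if_neg (by omega), if_neg (by omega)] at this
      push_cast at this ⊢
      rw [if_neg (by omega), if_pos (Or.inr rfl), if_pos le_rfl,
        show -((n : ℤ) + 1) - 1 = -(n + 2) by ring, this,
        show -((n : ℤ) + 1 + 1) = -(n + 2) by ring]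
    · by_cases h' : a = n + 2
      · subst h'
        have := ih (by omega) (a := n + 1) (by omega) (by omega)
        rw [if_neg (by omega), if_pos rfl] at this
        push_cast at this ⊢
        rw [if_pos (by omega), if_neg (by omega), if_pos (by omega),
          show -((n : ℤ) + 2) + 1 = -(n + 1) by ring, this]
      · have := ih (by omega) ha har
        rw [if_neg (by omega), if_neg (by omega)] at this
        rw [this]
        split_ifs <;> first | (exfalso; omega) | rfl

theorem sbarStep_cycle_full (hr : 3 ≤ r) (hZ : ∀ n < r, Z (n + 1) = sbarStep r (n + 1) (Z n)) :
    (∀ a : ℕ, 1 ≤ a → a ≤ r → Z r a = if a + 2 ≤ r then Z 0 (a + 1) else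
      if a + 1 = r then Z 0 (-1) else -Z 0 (-(r : ℤ))) ∧
    ∀ a : ℕ, 1 ≤ a → a ≤ r → Z r (-(a : ℤ)) = if a + 2 ≤ r then -Z 0 (-((a : ℤ) + 1)) else
      if a + 1 = r then -((-1) ^ (r - 1) * Z 0 1) else -Z 0 r := by
  obtain ⟨n, rfl⟩ : ∃ n, r = n + 1 := ⟨r - 1, by omega⟩
  have hp := fun a h1 h2 => sbarStep_cycle_pos hZ (n := n) (by omega) (a := a) h1 h2
  have hm := fun a h1 h2 => sbarStep_cycle_neg hZ (n := n) (by omega) (a := a) h1 h2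
  have hn : (((n + 1 : ℕ) : ℤ)) - 1 = n := by push_cast; ring
  have p1 := hp n (by omega) (by omega)
  have p2 := hp (n + 1) (by omega) (by omega)
  have m1 := hm n (by omega) (by omega)
  have m2 := hm (n + 1) (by omega) (by omega)
  rw [if_pos le_rfl] at p1 m1
  rw [if_neg (by omega), if_pos rfl] at p2 m2
  rw [hZ n (by omega)]
  unfold sbarStep
  rw [hn]
  refine ⟨fun a h1 h2 => ?_, fun a h1 h2 => ?_⟩
  · have h := hp a h1 h2
    split_ifs at h ⊢ <;> first | (exfalso; omega) | skip
    · rw [m1]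
      push_cast
      rfl
    · exact m2
    · exact h
  · have h := hm a h1 h2
    split_ifs at h ⊢ <;> first | (exfalso; omega) | skip
    · rw [p1]
      push_cast
      rfl
    · rw [p2, Nat.add_sub_cancel]
    · exact h

/-- The linear form with coordinates `z` is `ε • v_E^*`. -/
def IsUnitRow (r : ℕ) (ε : ℂ) (E : ℤ) (z : ℤ → ℂ) : Prop :=
  ∀ a : ℕ, 1 ≤ a → a ≤ r → z a = unitRow ε E a ∧ z (-(a : ℤ)) = unitRow ε E (-(a : ℤ))

theorem IsUnitRow.eval {ε : ℂ} {E : ℤ} {z : ℤ → ℂ} (h : IsUnitRow r ε E z) (a : ℤ) (h0 : a ≠ 0)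
    (h1 : -(r : ℤ) ≤ a) (h2 : a ≤ r) : z a = unitRow ε E a := by
  rcases lt_or_gt_of_ne h0 with h3 | h3
  · obtain ⟨n, rfl⟩ : ∃ n : ℕ, a = -(n : ℤ) := ⟨(-a).toNat, by omega⟩
    exact (h n (by omega) (by omega)).2
  · obtain ⟨n, rfl⟩ : ∃ n : ℕ, a = (n : ℤ) := ⟨a.toNat, by omega⟩
    exact (h n (by omega) (by omega)).1

/-- A cycle is a Coxeter element; it moves `v_E^*` to `v_{E-1}^*` for `2 ≤ E < r`, moves `v_{ā}^*` to
`- v_b^*` with `b = (a - 1)̄`, and moves the form of `1̄` to that of `r - 1`. -/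
theorem IsUnitRow.cycle (hr : 3 ≤ r) (hZ : ∀ n < r, Z (n + 1) = sbarStep r (n + 1) (Z n))
    {ε ε' : ℂ} {E E' : ℤ} (h : IsUnitRow r ε E (Z 0))
    (hE : (2 ≤ E ∧ E < r ∧ E' = E - 1 ∧ ε' = ε) ∨
      (E < -1 ∧ -(r : ℤ) < E ∧ E' = E + 1 ∧ ε' = -ε) ∨ (E = -1 ∧ E' = r - 1 ∧ ε' = ε)) :
    IsUnitRow r ε' E' (Z r) := by
  intro a ha har
  have hz := h.eval
  obtain ⟨z1, z2⟩ := sbarStep_cycle_full hr hZ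
  rw [z1 a ha har, z2 a ha har, hz (-1) (by omega) (by omega) (by omega),
    hz 1 (by omega) (by omega) (by omega), hz (-(r : ℤ)) (by omega) (by omega) (by omega),
    hz r (by omega) (by omega) (by omega)]
  by_cases h1 : a + 2 ≤ r
  · rw [if_pos h1, if_pos h1, hz (a + 1) (by omega) (by omega) (by omega),
      hz (-((a : ℤ) + 1)) (by omega) (by omega) (by omega)]
    unfold unitRow
    constructor
    · split_ifs <;> first | rfl | (exfalso; omega) | (rcases hE with hE | hE | hE <;>
        first | (exfalso; omega) | simp [hE.2.2])
    · split_ifs <;> first | rfl | (exfalso; omega) | (rcases hE with hE | hE | hE <;>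
        first | (exfalso; omega) | simp [hE.2.2])
  · rw [if_neg h1, if_neg h1]
    unfold unitRow
    constructor
    · split_ifs <;> first | rfl | (exfalso; omega) | (rcases hE with hE | hE | hE <;>
        first | (exfalso; omega) | simp [hE.2.2])
    · split_ifs <;> first | rfl | (exfalso; omega) | simp

theorem IsUnitRow.partial_cycle (hZ : ∀ n < r, Z (n + 1) = sbarStep r (n + 1) (Z n))
    {n : ℕ} (hn : n < r) {ε : ℂ} {i : ℕ} (hi : 1 ≤ i) (hin : i ≤ n)
    (h : IsUnitRow r ε ((i : ℤ) + 1) (Z 0)) : IsUnitRow r ε i (Z n) := by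
  intro a ha har
  have hz := h.eval
  rw [sbarStep_cycle_pos hZ hn ha har, sbarStep_cycle_neg hZ hn ha har,
    hz (-1) (by omega) (by omega) (by omega), hz 1 (by omega) (by omega) (by omega),
    hz a (by omega) (by omega) (by omega), hz (-(a : ℤ)) (by omega) (by omega) (by omega)]
  by_cases h1 : a ≤ n
  · rw [if_pos h1, if_pos h1, hz (a + 1) (by omega) (by omega) (by omega),
      hz (-((a : ℤ) + 1)) (by omega) (by omega) (by omega)]
    unfold unitRow
    constructor
    · split_ifs <;> first | rfl | (exfalso; omega)
    · split_ifs <;> first | (exfalso; omega) | simp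
  · rw [if_neg h1, if_neg h1]
    unfold unitRow
    constructor
    · split_ifs <;> first | (exfalso; omega) | simp
    · split_ifs <;> first | (exfalso; omega) | simp

end cycle

/-- The images of a row vector under the initial products of the representatives along the periodic
word. -/
def sbarSeq (r : ℕ) (z : ℤ → ℂ) : ℕ → ℤ → ℂ
  | 0 => z
  | p + 1 => sbarStep r (p % r + 1) (sbarSeq r z p)

/-- The images of a row vector under the initial products of the `x_{-i}` along the periodic word,
where `c l j` is the parameter of the letter `j` in the `l`-th cycle. -/
def rowSeq (r : ℕ) (c : ℕ → ℕ → ℂ) (z : ℤ → ℂ) : ℕ → ℤ → ℂ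
  | 0 => z
  | p + 1 => rowStep r (p % r + 1) (c (p / r + 1) (p % r + 1)) (rowSeq r c z p)

theorem sbarSeq_cycle {r : ℕ} (z : ℤ → ℂ) (l n : ℕ) (hn : n < r) :
    sbarSeq r z (l * r + (n + 1)) = sbarStep r (n + 1) (sbarSeq r z (l * r + n)) := by
  rw [← add_assoc, sbarSeq, add_comm (l * r) n, Nat.add_mul_mod_self_right, Nat.mod_eq_of_lt hn]

theorem rowSeq_cycle {r : ℕ} (c : ℕ → ℕ → ℂ) (z : ℤ → ℂ) (l n : ℕ) (hn : n < r) :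
    rowSeq r c z (l * r + (n + 1)) =
      rowStep r (n + 1) (c (l + 1) (n + 1)) (rowSeq r c z (l * r + n)) := by
  rw [← add_assoc, rowSeq, add_comm (l * r) n, Nat.add_mul_mod_self_right, Nat.mod_eq_of_lt hn,
    Nat.add_mul_div_right _ _ (by omega), Nat.div_eq_of_lt hn, zero_add]

/-! ### Evaluation of the minor -/

theorem coord_zero {r n : ℕ} (Y : Fin n → ℂˣ) (s : ℕ) : coord r Y s 0 = 1 := by
  simp [coord]

theorem coord_ne_zero {r n : ℕ} (Y : Fin n → ℂˣ) (s j : ℕ) : coord r Y s j ≠ 0 := by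
  unfold coord
  split_ifs
  · exact one_ne_zero
  · exact Units.ne_zero _
  · exact one_ne_zero

theorem coord_div_mod {r n : ℕ} (hr : 0 < r) (Y : Fin n → ℂˣ) (p : Fin n) :
    coord r Y ((p : ℕ) / r + 1) ((p : ℕ) % r + 1) = Y p := by
  have h := Nat.mod_lt (p : ℕ) hr
  have h2 : ((p : ℕ) / r + 1 - 1) * r + ((p : ℕ) % r + 1 - 1) = p := by
    rw [Nat.add_sub_cancel, Nat.add_sub_cancel, mul_comm]
    exact Nat.div_add_mod _ _
  rw [coord, if_neg (by omega), dif_pos (by rw [h2]; exact p.2)]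
  congr 2
  exact Fin.ext h2

theorem isWeight_D {r m n : ℕ} (hr : 3 ≤ r) (hmr : m ≤ r) (Y : Fin n → ℂˣ) :
    IsWeight r m (coord r Y) fun n k => D r Y (lIndex r m n k) k := by
  refine ⟨fun q a ha har hq => ?_, fun q => ?_, fun q => ?_, fun q a ha har => ?_⟩
  · have h : lIndex r m (q + a + 1 - m) (a : ℤ) = q + 1 := by
      rw [lIndex, if_pos (by omega)]
      omega
    rw [h, D, if_pos (by omega), Int.natAbs_natCast, if_pos har]
  · obtain ⟨b, rfl⟩ : ∃ b, r = b + 1 := ⟨r - 1, by omega⟩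
    have e : (((b + 1 : ℕ) : ℤ)) - 1 = (b : ℕ) := by push_cast; ring
    have h : lIndex (b + 1) m (q + (b + 1) - m) (b : ℤ) = q + 1 := by
      rw [lIndex, if_pos (by omega)]
      omega
    rw [e, h, D, if_pos (by omega), Int.natAbs_natCast, if_neg (by omega), if_pos rfl]
  · have h : lIndex r m (q + r - m) (r : ℤ) = q := by
      rw [lIndex, if_neg (by omega)]
      omega
    rw [h, D, if_pos (by omega), Int.natAbs_natCast, if_neg (by omega), if_neg (by omega)]
  · have h : lIndex r m (q + r - m) (-(a : ℤ)) = q := by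
      rw [lIndex, if_neg (by omega)]
      omega
    rw [h, D, if_neg (by omega), Int.natAbs_neg, Int.natAbs_natCast, barWeight]
    split_ifs with h
    · rw [show r - 2 = a - 1 by omega]
    · rfl

/-- The sign of the unit row vector at the letter `upperBound r m d (j + 1)` that the representative
of `u_{≤k}` carries to a unit row vector at one of the letters `1, …, d`. -/
def rowSign (r m d j : ℕ) : ℂ := if j + 1 ≤ r - m then 1 else (-1) ^ (d - (j + 1))

/-- The permutation of `{0, …, d - 1}` that reverses `{s, …, d - 1}` and fixes the other points. -/
def reverseFrom (d s : ℕ) : Equiv.Perm (Fin d) :=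
  Function.Involutive.toPerm
    (fun j => ⟨if (j : ℕ) < s then j else d - 1 + s - j, by split_ifs <;> omega⟩) fun j => by
      have := j.2
      apply Fin.ext
      dsimp only
      split_ifs <;> omega

theorem reverseFrom_apply (d s : ℕ) (j : Fin d) :
    (reverseFrom d s j : ℕ) = if (j : ℕ) < s then (j : ℕ) else d - 1 + s - j := rfl

/-- The signs of the rows cancel against the permutation of the rows. -/
theorem sign_reverseFrom (r m d : ℕ) :
    ((Equiv.Perm.sign (reverseFrom d (r - m)) : ℤ) : ℂ) = ∏ j : Fin d, rowSign r m d j := by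
  rw [Equiv.Perm.sign_eq_prod_prod_Ioi]
  push_cast
  refine Finset.prod_congr rfl fun i _ => ?_
  unfold rowSign
  split_ifs with h
  · refine Finset.prod_eq_one fun j hj => ?_
    rw [Finset.mem_Ioi, Fin.lt_def] at hj
    have := j.2
    rw [if_pos]
    · simp
    · rw [Fin.lt_def, reverseFrom_apply, reverseFrom_apply]
      split_ifs <;> omega
  · -- every pair `i < j` in the reversed part is an inversion
    rw [show d - ((i : ℕ) + 1) = (Finset.Ioi i).card by rw [Fin.card_Ioi]; omega]
    refine Finset.prod_eq_pow_card fun j hj => ?_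
    rw [Finset.mem_Ioi, Fin.lt_def] at hj
    have := j.2
    rw [if_neg]
    · simp
    · rw [Fin.lt_def, reverseFrom_apply, reverseFrom_apply]
      split_ifs <;> omega

/-- The row that belongs to the letter `b` after `l` cycles: the bars `j̄` lose one step in each cycle
until they pass from `1̄` to `r - 1`, and the unbarred letters go down by one step in each cycle. -/
theorem sbarSeq_isUnitRow {r m d : ℕ} (hdr : d < r - 1) (hm : 2 ≤ m) (hmr : m ≤ r - 1) {b : ℕ}
    (hb : 1 ≤ b) (hbd : b ≤ d) (l : ℕ) (hl : l ≤ m - 2) {z : ℤ → ℂ}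
    (hz : z = if b ≤ r - m then unitRow 1 ((m : ℤ) - 1 + b)
      else unitRow ((-1) ^ (b - (r - m) - 1)) (-((b : ℤ) - (r - m : ℕ)))) :
    IsUnitRow r (if b ≤ r - m + l then 1 else (-1) ^ (b - (r - m + l) - 1))
      (if b ≤ r - m + l then (m : ℤ) - 1 + b - l else -((b : ℤ) - (r - m + l : ℕ)))
      (sbarSeq r z (l * r)) := by
  induction l with
  | zero =>
    intro a _ _
    rw [zero_mul, sbarSeq, hz]
    simp only [add_zero, Nat.cast_zero, sub_zero]
    split_ifs <;> exact ⟨rfl, rfl⟩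
  | succ l ih =>
    have h := IsUnitRow.cycle (Z := fun n => sbarSeq r z (l * r + n)) (by omega)
      (fun n hn => sbarSeq_cycle z l n hn) (ih (by omega)) (ε' := if b ≤ r - m + (l + 1) then 1
        else (-1) ^ (b - (r - m + (l + 1)) - 1)) (E' := if b ≤ r - m + (l + 1) then
        (m : ℤ) - 1 + b - (l + 1 : ℕ) else -((b : ℤ) - (r - m + (l + 1) : ℕ))) ?_
    · rw [add_one_mul]
      exact h
    · by_cases h1 : b ≤ r - m + l
      · rw [if_pos h1, if_pos h1, if_pos (by omega), if_pos (by omega)]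
        exact Or.inl ⟨by omega, by omega, by omega, rfl⟩
      · rw [if_neg h1, if_neg h1]
        by_cases h2 : b ≤ r - m + (l + 1)
        · rw [if_pos h2, if_pos h2, show b - (r - m + l) - 1 = 0 by omega, pow_zero]
          exact Or.inr (Or.inr ⟨by omega, by omega, rfl⟩)
        · rw [if_neg h2, if_neg h2,
            show b - (r - m + l) - 1 = b - (r - m + (l + 1)) - 1 + 1 by omega, pow_succ]
          exact Or.inr (Or.inl ⟨by omega, by omega, by omega, by ring⟩)

/-- The representative of `u_{≤k}` carries the rows at the upper bounds, with signs, to the rows at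
`1, …, d`, up to the permutation `reverseFrom`. -/
theorem row_unitRow_vecMul_ubar {r m d : ℕ} (hdr : d < r - 1) (hm : 2 ≤ m) (hmr : m ≤ r - 1)
    {n : ℕ} (hn : (m - 2) * r + d ≤ n) (hr : 0 < r) (j : Fin d) :
    row r (unitRow (rowSign r m d j) (upperBound r m d (j + 1))) ᵥ*
      vec (ubar ((List.ofFn (cyclicWord hr n)).take ((m - 2) * r + d))) =
    Pi.single (letter (by omega) (reverseFrom d (r - m) j)) 1 := by
  have hj := j.2
  set z := unitRow (rowSign r m d j) (upperBound r m d (j + 1)) with hz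
  set b : ℕ := (reverseFrom d (r - m) j : ℕ) + 1 with hb
  have hb' := reverseFrom_apply d (r - m) j
  have h := row_vecMul_list_prod (by omega)
    (((List.ofFn (cyclicWord hr n)).take ((m - 2) * r + d)).map sbar) (sbarSeq r z) ?_
  · rw [ubar]
    refine h.trans ?_
    have hlen : (((List.ofFn (cyclicWord hr n)).take ((m - 2) * r + d)).map
        (sbar (r := r))).length = (m - 2) * r + d := by
      simp [hn]
    rw [hlen]
    have h1 := sbarSeq_isUnitRow hdr hm hmr (b := b) (by omega) (by
      have := (reverseFrom d (r - m) j).2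
      omega) (m - 2) le_rfl (z := z) ?_
    · rw [if_pos (by have := (reverseFrom d (r - m) j).2; omega),
        if_pos (by have := (reverseFrom d (r - m) j).2; omega),
        show (m : ℤ) - 1 + b - (m - 2 : ℕ) = b + 1 by omega] at h1
      have h2 := IsUnitRow.partial_cycle (Z := fun n => sbarSeq r z ((m - 2) * r + n))
        (fun n hn => sbarSeq_cycle z (m - 2) n hn) (n := d) (by omega) (i := b) (by omega)
        (by have := (reverseFrom d (r - m) j).2; omega) h1
      funext a
      rw [row, h2.eval _ a.bounds.1 a.bounds.2.1 a.bounds.2.2, unitRow, Pi.single_apply]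
      congr 1
      rw [Subtype.ext_iff, hb]
      simp [letter]
    · rw [hz]
      unfold rowSign upperBound
      by_cases h3 : (j : ℕ) + 1 ≤ r - m
      · rw [if_pos (by omega)] at hb'
        rw [if_pos h3, if_pos h3, if_pos (by omega), hb, hb']
      · rw [if_neg (by omega)] at hb'
        rw [if_neg h3, if_neg h3, if_neg (by omega),
          show b - (r - m) - 1 = d - ((j : ℕ) + 1) by omega]
        congr 1
        omega
  · intro p hp
    rw [List.getElem_map, List.getElem_take, List.getElem_ofFn, row_vecMul_sbar (by omega)]
    rfl

/-- The rows of `vec (ubar⁻¹ g)` in terms of those of `vec g`. -/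
theorem vec_ubar_inv_mul {r : ℕ} (hr : 3 ≤ r) {u g : G r} {v : JD r → ℂ} {a : JD r}
    (h : v ᵥ* vec u = Pi.single a 1) (b : JD r) : vec (u⁻¹ * g) a b = (v ᵥ* vec g) b := by
  have h2 : vec (u⁻¹ * g) a = Pi.single a 1 ᵥ* vec (u⁻¹ * g) := by
    rw [Matrix.single_one_vecMul]
    rfl
  rw [h2, ← h, Matrix.vecMul_vecMul, ← vec_mul hr, mul_inv_cancel_left]

theorem row_vecMul_xL {r n : ℕ} (hr : 3 ≤ r) (hr0 : 0 < r) (Y : Fin n → ℂˣ) (z : ℤ → ℂ) :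
    row r z ᵥ* vec (xL (cyclicWord hr0 n) Y) = row r (rowSeq r (coord r Y) z n) := by
  have h := row_vecMul_list_prod hr (List.ofFn fun p => xneg (cyclicWord hr0 n p) (Y p))
    (rowSeq r (coord r Y) z) ?_
  · rw [List.length_ofFn] at h
    exact h
  · intro p hp
    rw [List.length_ofFn] at hp
    rw [List.getElem_ofFn, row_vecMul_xneg hr, rowSeq, coord_div_mod hr0 Y ⟨p, hp⟩]
    rfl

theorem rowSeq_isChainRow {r m d : ℕ} (hdr : d < r - 1) (hm : 2 ≤ m) (hmr : m ≤ r - 1)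
    {c : ℕ → ℕ → ℂ} {F : ℕ → ℤ → ℂ} (hF : IsWeight r m c F) (c0 : ∀ s, c s 0 = 1) (ε : ℂ)
    {j : ℕ} (hj : j < d) (q : ℕ) (hq : 1 ≤ q) :
    IsChainRow r m c F (ε * if r - m < j + 1 then (c 1 (d - (j + 1)))⁻¹ else 1)
      (upperBound r m d (j + 1)) (min (j + 1) (r - m + 1)) q
      (rowSeq r c (unitRow ε (upperBound r m d (j + 1))) (q * r)) := by
  have hstep : ∀ q, min (j + 1) (r - m + 1) ≤ q + r - m →
      ∀ a : ℕ, 1 ≤ a → a + 2 ≤ r → q + a + 2 = m + min (j + 1) (r - m + 1) →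
      ordLE r a (upperBound r m d (j + 1)) ∧ ordLE r ((a : ℤ) + 1) (upperBound r m d (j + 1)) := by
    intro q _ a _ _ _
    unfold upperBound
    split_ifs <;> unfold ordLE height <;> constructor <;> split_ifs <;> omega
  have hs : ∀ q, min (j + 1) (r - m + 1) ≤ q + r - m →
      IsChainRow r m c F (ε * if r - m < j + 1 then (c 1 (d - (j + 1)))⁻¹ else 1)
        (upperBound r m d (j + 1)) (min (j + 1) (r - m + 1)) q
        (rowSeq r c (unitRow ε (upperBound r m d (j + 1))) (q * r)) →
      IsChainRow r m c F (ε * if r - m < j + 1 then (c 1 (d - (j + 1)))⁻¹ else 1)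
        (upperBound r m d (j + 1)) (min (j + 1) (r - m + 1)) (q + 1)
        (rowSeq r c (unitRow ε (upperBound r m d (j + 1))) ((q + 1) * r)) := by
    intro q hq h
    rw [add_one_mul]
    exact h.step (by omega) (by omega) hF (by omega) hq (hstep q hq)
      (Z := fun n => rowSeq r c (unitRow ε (upperBound r m d (j + 1))) (q * r + n)) rfl (c0 _)
      fun n hn => rowSeq_cycle c _ q n hn
  induction q, hq using Nat.le_induction with
  | base =>
    by_cases h : j + 1 ≤ r - m
    · refine hs 0 (by omega) ?_
      rw [if_neg (by omega), mul_one, zero_mul, rowSeq, upperBound, if_pos h,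
        Nat.min_eq_left (by omega)]
      exact isChainRow_unitRow_pos (by omega) (by omega) ε (by omega) (by omega)
    · rw [if_pos (by omega), one_mul, Nat.min_eq_right (by omega)]
      have := isChainRow_unitRow_neg (F := F) (m := m) (r := r) (by omega) (by omega) ε
        (j := d - (j + 1) + 1) (by omega) (by omega)
        (Z := rowSeq r c (unitRow ε (upperBound r m d (j + 1)))) ?_ (c0 1) fun n hn => ?_
      · rw [upperBound, if_neg h]
        rw [upperBound, if_neg h] at this
        push_cast at this ⊢
        simpa [div_eq_mul_inv] using this
      · rw [rowSeq, upperBound, if_neg h]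
        push_cast
        rfl
      · have := rowSeq_cycle c (unitRow ε (upperBound r m d (j + 1))) 0 n hn
        simpa using this
  | succ q hq ih => exact hs q (by omega) ih

/-- The last, incomplete cycle `1, …, d` acts on the coordinates `1, …, d` like a complete one. -/
theorem rowSeq_apply {r m d : ℕ} (hdr : d < r - 1) (hm : 2 ≤ m) (hmr : m ≤ r - 1)
    {c : ℕ → ℕ → ℂ} {F : ℕ → ℤ → ℂ} (hF : IsWeight r m c F) (c0 : ∀ s, c s 0 = 1) (ε : ℂ)
    {j : ℕ} (hj : j < d) {b : ℕ} (hb : 1 ≤ b) (hbd : b ≤ d) :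
    rowSeq r c (unitRow ε (upperBound r m d (j + 1))) ((m - 1) * r + d) b =
      (ε * if r - m < j + 1 then (c 1 (d - (j + 1)))⁻¹ else 1) *
        chainSum r F (upperBound r m d (j + 1)) (min (j + 1) (r - m + 1)) (b + 1) b := by
  have h := rowSeq_isChainRow hdr hm hmr hF c0 ε hj (m - 1) (by omega)
  have h2 := rowStep_cycle_pos (t := c (m - 1 + 1))
    (Z := fun n => rowSeq r c (unitRow ε (upperBound r m d (j + 1))) ((m - 1) * r + n))
    (fun n hn => rowSeq_cycle c _ (m - 1) n hn) (c0 _) (n := d) (by omega) hb (by omega)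
  rw [if_pos hbd] at h2
  refine h2.trans ?_
  have h3 := h.upper hF (by omega) (a := b) ?_ hb (by omega)
  · rw [show m - 1 + 1 + b + 1 - m = b + 1 by omega] at h3
    exact h3
  · intro a _ _ _
    unfold upperBound
    split_ifs <;> unfold ordLE height <;> constructor <;> split_ifs <;> omega

open Classical in
/-- The formula for the minor `Δ(k; i)`, realized in the vector representation. -/
theorem leadingMinor_xL {r m d : ℕ} (hd : 1 ≤ d) (hdr : d < r - 1) (hm : 2 ≤ m) (hmr : m ≤ r - 1)
    (hr : 0 < r) (Y : Fin ((m - 1) * r + d) → ℂˣ) :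
    leadingMinor (r := r) (d := d) (by omega)
      ((ubar ((List.ofFn (cyclicWord hr ((m - 1) * r + d))).take ((m - 2) * r + d)))⁻¹ *
        xL (cyclicWord hr ((m - 1) * r + d)) Y) =
    ∑ κ : Fin d → JD r with Admissible r m d κ,
      ∏ i : Fin d, D r Y (lIndex r m ((i : ℕ) + 1) (κ i)) (κ i) := by
  have hn : (m - 2) * r + d ≤ (m - 1) * r + d :=
    Nat.add_le_add_right (Nat.mul_le_mul_right _ (by omega)) _
  set F : ℕ → ℤ → ℂ := fun n k => D r Y (lIndex r m n k) k with hFdef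
  have hF : IsWeight r m (coord r Y) F := isWeight_D (by omega) (by omega) Y
  have hsq : (∏ j : Fin d, rowSign r m d j) * ∏ j : Fin d, rowSign r m d j = 1 := by
    rw [← Finset.prod_mul_distrib]
    refine Finset.prod_eq_one fun j _ => ?_
    unfold rowSign
    split_ifs
    · rw [one_mul]
    · rw [← mul_pow]
      simp
  have h1 := Matrix.det_permute (reverseFrom d (r - m)) ((vec ((ubar ((List.ofFn (cyclicWord hr
    ((m - 1) * r + d))).take ((m - 2) * r + d)))⁻¹ * xL (cyclicWord hr ((m - 1) * r + d))
    Y)).submatrix (letter (r := r) (d := d) (by omega)) (letter (by omega)))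
  have h2 := det_truncatedChainMatrix_zero F (coord r Y) hdr hm hmr (coord_ne_zero Y)
    (coord_zero Y) ?_
  · have h3 : (((vec ((ubar ((List.ofFn (cyclicWord hr
      ((m - 1) * r + d))).take ((m - 2) * r + d)))⁻¹ * xL (cyclicWord hr ((m - 1) * r + d))
      Y)).submatrix (letter (r := r) (d := d) (by omega)) (letter (by omega))).submatrix
      (reverseFrom d (r - m)) id) = Matrix.of fun i b : Fin d => rowSign r m d i *
      (Matrix.of fun i b : Fin d => (if r - m < (i : ℕ) + 1 then
        (coord r Y 1 (d - (i + 1)))⁻¹ else 1) * chainSum r F (upperBound r m d (i + 1))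
          (min ((i : ℕ) + 1) (r - m + 1)) ((b : ℕ) + 2) ((b : ℤ) + 1)) i b := by
      ext j b
      have hb := b.2
      rw [Matrix.submatrix_apply, Matrix.submatrix_apply, vec_ubar_inv_mul (by omega)
        (row_unitRow_vecMul_ubar hdr hm hmr hn hr j), row_vecMul_xL (by omega)]
      have h4 := rowSeq_apply hdr hm hmr hF (coord_zero Y) (rowSign r m d j) j.2
        (b := (b : ℕ) + 1) (by omega) (by omega)
      push_cast at h4
      simp only [row, letter, id, Matrix.of_apply]
      rw [h4, mul_assoc]
    rw [h3, Matrix.det_mul_column, h2, sign_reverseFrom] at h1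
    rw [leadingMinor]
    have h5 := congrArg (fun a => (∏ j : Fin d, rowSign r m d j) * a) h1
    simp only [← mul_assoc, hsq, one_mul] at h5
    rw [← h5]
    obtain ⟨n, rfl⟩ : ∃ n, d = n + 1 := ⟨d - 1, by omega⟩
    rw [det_chainEntry (upperBound_mono hdr hm hmr) n fun b hb => ?_]
    · simp only [admissible_iff, hFdef]
    · have := le_upperBound (d := n + 1) hdr hm hmr (b + 1) (b + 2) (by omega) (by omega) (by omega)
      push_cast at this
      exact this
  · intro s j hj
    have h4 := hF.neg (s + 1) (j + 1) (by omega) (by omega)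
    rw [show s + 1 + r - m = r - m + s + 1 by omega, barWeight, if_neg (by omega)] at h4
    push_cast at h4
    exact h4

end

end TypeD

open Classical in
theorem theorem7p1 (r m d : ℕ) (hd : 1 ≤ d) (hdr : d < r - 1) (hm : 2 ≤ m) (hmr : m ≤ r - 1)
    (k : Fin ((m - 1) * r + d)) (hk : (k : ℕ) + 1 = (m - 2) * r + d) :
    (∃! Δ : TypeD.G r → ℂ,
      TypeD.IsInitialMinor (TypeD.cyclicWord (r := r) (by omega) ((m - 1) * r + d)) k Δ) ∧
    ∀ Δ : TypeD.G r → ℂ,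
      TypeD.IsInitialMinor (TypeD.cyclicWord (r := r) (by omega) ((m - 1) * r + d)) k Δ →
      ∀ Y : Fin ((m - 1) * r + d) → ℂˣ,
        Δ (TypeD.xL (TypeD.cyclicWord (r := r) (by omega) ((m - 1) * r + d)) Y) =
          ∑ κ : Fin d → TypeD.JD r with TypeD.Admissible r m d κ,
            ∏ i : Fin d, TypeD.D r Y (TypeD.lIndex r m ((i : ℕ) + 1) (κ i)) (κ i) := by
  have hj : (TypeD.cyclicWord (r := r) (by omega) ((m - 1) * r + d) k : ℕ) + 1 = d := by
    have h : (k : ℕ) = d - 1 + (m - 2) * r := by omega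
    rw [TypeD.cyclicWord]
    dsimp only
    rw [h, Nat.add_mul_mod_self_right, Nat.mod_eq_of_lt (by omega)]
    omega
  have hmin := TypeD.isGeneralizedMinor_leadingMinor (r := r) (d := d) (by omega) (by omega) _ hj
    ((List.ofFn (TypeD.cyclicWord (r := r) (by omega) ((m - 1) * r + d))).take ((k : ℕ) + 1))
  have huniq := fun Δ (h : TypeD.IsInitialMinor
    (TypeD.cyclicWord (r := r) (by omega) ((m - 1) * r + d)) k Δ) =>
    TypeD.isGeneralizedMinor_unique (by omega) _ _ h hmin
  refine ⟨⟨_, hmin, huniq⟩, fun Δ hΔ Y => ?_⟩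
  rw [huniq Δ hΔ]
  dsimp only
  rw [hk]
  exact TypeD.leadingMinor_xL hd hdr hm hmr (by omega) Y
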